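/- Let $\mathbb K$ be a field of characteristic zero and let $n\ge 2$, $m\ge 1$ be integers. Let $SL^{n,m}$ be the Lie superalgebra over $\mathbb K$ whose even part has basis $X_1,\dots,X_n,T_1,T_2,T_3$, whose odd part has basis $Y_1,\dots,Y_m$, and whose only non-zero brackets of basis vectors (up to super skew-symmetry) are $$[X_1,X_i]=X_{i+1}\ (2\le i\le n-1),\qquad [X_1,Y_j]=Y_{j+1}\ (1\le j\le m-1),$$ $$[T_1,X_i]=iX_i\ (1\le i\le n),\qquad [T_1,Y_j]=jY_j\ (1\le j\le m),$$ $$[T_2,X_i]=X_i\ (2\le i\le n),\qquad [T_3,Y_j]=Y_j\ (1\le j\le m).$$ For a Lie superalgebra $\mathfrak g=\mathfrak g_{\bar 0}\oplus\mathfrak g_{\bar 1}$ let $C^q(\mathfrak g;\mathfrak g)=\bigoplus_{q_0+q_1=q}\mathrm{Hom}(\wedge^{q_0}\mathfrak g_{\bar 0}\otimes S^{q_1}\mathfrak g_{\bar 1},\mathfrak g)$, with the differential $$\begin{aligned}(dc)(g_1,\dots,g_{q_0},h_1,\dots,h_{q_1})={}&\sum_{1\le s<t\le q_0}(-1)^{s+t-1}c([g_s,g_t],g_1,\dots,\hat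 g_s,\dots,\hat g_t,\dots,g_{q_0},h_1,\dots,h_{q_1})\\&+\sum_{s=1}^{q_0}\sum_{t=1}^{q_1}(-1)^{s-1}c(g_1,\dots,\hat g_s,\dots,g_{q_0},[g_s,h_t],h_1,\dots,\hat h_t,\dots,h_{q_1})\\&+\sum_{1\le s<t\le q_1}c([h_s,h_t],g_1,\dots,g_{q_0},h_1,\dots,\hat h_s,\dots,\hat h_t,\dots,h_{q_1})\\&+\sum_{s=1}^{q_0}(-1)^s[g_s,c(g_1,\dots,\hat g_s,\dots,g_{q_0},h_1,\dots,h_{q_1})]\\&+(-1)^{q_0-1}\sum_{s=1}^{q_1}[h_s,c(g_1,\dots,g_{q_0},h_1,\dots,\hat h_s,\dots,h_{q_1})],\end{aligned}$$ where $g_i\in\mathfrak g_{\bar 0}$ and $h_j\in\mathfrak g_{\bar 1}$, and let $H^q(\mathfrak g;\mathfrak g)$ be the cohomology of this complex (even and odd classes together). Then $SL^{n,m}$ is a complete Lie superalgebra, that is, $$H^i(SL^{n,m};SL^{n,m})=\{0\}\qquad\text{for } i=0,1,2.$$ -/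

import Mathlib

/-- A Lie superalgebra structure on a `K`-vector space `L` (intended for `K` of characteristic zero):
a decomposition of `L` into an even part `part 0` and an odd part `part 1`, and an even bilinear
bracket that is super skew-symmetric and satisfies the graded Jacobi identity. -/
structure LieSuperalgebra (K L : Type*) [Field K] [AddCommGroup L] [Module K L] where
  part : ZMod 2 → Submodule K L
  isCompl : IsCompl (part 0) (part 1)
  bracket : L →ₗ[K] L →ₗ[K] L
  bracket_mem : ∀ (α β : ZMod 2) (x y : L), x ∈ part α → y ∈ part β →
    bracket x y ∈ part (α + β)
  bracket_skew : ∀ (α β : ZMod 2) (x y : L), x ∈ part α → y ∈ part β →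
    bracket x y = -((-1 : K) ^ (α.val * β.val) • bracket y x)
  jacobi : ∀ (α β γ : ZMod 2) (x y z : L), x ∈ part α → y ∈ part β → z ∈ part γ →
    (-1 : K) ^ (γ.val * α.val) • bracket x (bracket y z)
      + (-1 : K) ^ (α.val * β.val) • bracket y (bracket z x)
      + (-1 : K) ^ (β.val * γ.val) • bracket z (bracket x y) = 0

namespace LieSuperalgebra

variable {K L : Type*} [Field K] [AddCommGroup L] [Module K L] (𝔤 : LieSuperalgebra K L)

/-- The bracket of two even elements, as an even element. -/
def brEE (x y : 𝔤.part 0) : 𝔤.part 0 :=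
  ⟨𝔤.bracket x y, 𝔤.bracket_mem 0 0 x y x.2 y.2⟩

/-- The bracket of an even and an odd element, as an odd element. -/
def brEO (x : 𝔤.part 0) (y : 𝔤.part 1) : 𝔤.part 1 :=
  ⟨𝔤.bracket x y, 𝔤.bracket_mem 0 1 x y x.2 y.2⟩

/-- The bracket of two odd elements, as an even element. -/
def brOO (x y : 𝔤.part 1) : 𝔤.part 0 :=
  ⟨𝔤.bracket x y, 𝔤.bracket_mem 1 1 x y x.2 y.2⟩

/-- The ambient space of the cochains with adjoint coefficients: families `c` of arbitrary functions
`c q₀ q₁ (g₁, …, g_{q₀}) (h₁, …, h_{q₁}) ∈ 𝔤`, with `q₀` even and `q₁` odd arguments. -/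
abbrev RawCochain : Type _ :=
  (q₀ q₁ : ℕ) → (Fin q₀ → 𝔤.part 0) → (Fin q₁ → 𝔤.part 1) → L

/-- `f` is an element of `Hom (⋀^{q₀} 𝔤₀ ⊗ S^{q₁} 𝔤₁, 𝔤)`: it is given by a map that is multilinear
and alternating in the even arguments and multilinear and symmetric in the odd ones. -/
def IsAltSymm {q₀ q₁ : ℕ} (f : (Fin q₀ → 𝔤.part 0) → (Fin q₁ → 𝔤.part 1) → L) : Prop :=
  ∃ φ : 𝔤.part 0 [⋀^Fin q₀]→ₗ[K] MultilinearMap K (fun _ : Fin q₁ => 𝔤.part 1) L,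
    (∀ (g : Fin q₀ → 𝔤.part 0) (h : Fin q₁ → 𝔤.part 1) (σ : Equiv.Perm (Fin q₁)),
      φ g (h ∘ σ) = φ g h) ∧
    ∀ (g : Fin q₀ → 𝔤.part 0) (h : Fin q₁ → 𝔤.part 1), f g h = φ g h

/-- The space of `q`-cochains
`C^q(𝔤; 𝔤) = ⨁_{q₀ + q₁ = q} Hom (⋀^{q₀} 𝔤₀ ⊗ S^{q₁} 𝔤₁, 𝔤)`. -/
def cochains (q : ℕ) : Submodule K 𝔤.RawCochain where
  carrier := {c | (∀ q₀ q₁, q₀ + q₁ = q → 𝔤.IsAltSymm (c q₀ q₁)) ∧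
    ∀ q₀ q₁, q₀ + q₁ ≠ q → c q₀ q₁ = 0}
  zero_mem' := ⟨fun _ _ _ => ⟨0, by simp, by simp⟩, fun _ _ _ => rfl⟩
  add_mem' := by
    rintro c c' ⟨h₁, h₂⟩ ⟨h₁', h₂'⟩
    refine ⟨fun q₀ q₁ hq => ?_, fun q₀ q₁ hq => ?_⟩
    · obtain ⟨φ, hs, hφ⟩ := h₁ q₀ q₁ hq
      obtain ⟨ψ, hs', hψ⟩ := h₁' q₀ q₁ hq
      exact ⟨φ + ψ, fun g h σ => by simp [hs, hs'], fun g h => by simp [hφ, hψ]⟩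
    · simp [h₂ q₀ q₁ hq, h₂' q₀ q₁ hq]
  smul_mem' := by
    rintro a c ⟨h₁, h₂⟩
    refine ⟨fun q₀ q₁ hq => ?_, fun q₀ q₁ hq => ?_⟩
    · obtain ⟨φ, hs, hφ⟩ := h₁ q₀ q₁ hq
      exact ⟨a • φ, fun g h σ => by simp [hs], fun g h => by simp [hφ]⟩
    · simp [h₂ q₀ q₁ hq]

/-- `∑_{s < t} (-1)^{s+t-1} c([g_s, g_t], g₁, …, ĝ_s, …, ĝ_t, …, h₁, …)`; the indices `s`, `t` of the
code start at `0`. -/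
def dEE (c : 𝔤.RawCochain) : 𝔤.RawCochain
  | k + 2, q₁, g, h => ∑ t : Fin (k + 2), ∑ s : Fin (k + 1) with s.castSucc < t,
      (-1 : K) ^ (s.val + t.val + 1) •
        c (k + 1) q₁
          (Fin.cons (𝔤.brEE (g s.castSucc) (g t)) (s.removeNth (t.removeNth g) : Fin k → _)) h
  | _, _, _, _ => 0

/-- `∑_{s, t} (-1)^{s-1} c(g₁, …, ĝ_s, …, [g_s, h_t], h₁, …, ĥ_t, …)`. -/
def dEO (c : 𝔤.RawCochain) : 𝔤.RawCochain
  | k + 1, l + 1, g, h => ∑ s : Fin (k + 1), ∑ t : Fin (l + 1),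
      (-1 : K) ^ s.val •
        c k (l + 1) (s.removeNth g : Fin k → _)
          (Fin.cons (𝔤.brEO (g s) (h t)) (t.removeNth h : Fin l → _))
  | _, _, _, _ => 0

/-- `∑_{s < t} c([h_s, h_t], g₁, …, h₁, …, ĥ_s, …, ĥ_t, …)`. -/
def dOO (c : 𝔤.RawCochain) : 𝔤.RawCochain
  | q₀, l + 2, g, h => ∑ t : Fin (l + 2), ∑ s : Fin (l + 1) with s.castSucc < t,
      c (q₀ + 1) l (Fin.cons (𝔤.brOO (h s.castSucc) (h t)) g)
        (s.removeNth (t.removeNth h) : Fin l → _)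
  | _, _, _, _ => 0

/-- `∑_s (-1)^s [g_s, c(g₁, …, ĝ_s, …, h₁, …)]`. -/
def dActE (c : 𝔤.RawCochain) : 𝔤.RawCochain
  | k + 1, q₁, g, h => ∑ s : Fin (k + 1),
      (-1 : K) ^ (s.val + 1) • 𝔤.bracket (g s) (c k q₁ (s.removeNth g : Fin k → _) h)
  | _, _, _, _ => 0

/-- `(-1)^{q₀-1} ∑_s [h_s, c(g₁, …, h₁, …, ĥ_s, …)]`. -/
def dActO (c : 𝔤.RawCochain) : 𝔤.RawCochain
  | q₀, l + 1, g, h => (-1 : K) ^ (q₀ + 1) •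
      ∑ s : Fin (l + 1), 𝔤.bracket (h s) (c q₀ l g (s.removeNth h : Fin l → _))
  | _, _, _, _ => 0

/-- The differential of Lie superalgebra cohomology with adjoint coefficients. -/
def d : 𝔤.RawCochain →ₗ[K] 𝔤.RawCochain where
  toFun c := 𝔤.dEE c + 𝔤.dEO c + 𝔤.dOO c + 𝔤.dActE c + 𝔤.dActO c
  map_add' c c' := by
    funext q₀ q₁ g h
    rcases q₀ with _ | _ | k <;> rcases q₁ with _ | _ | l <;>
      simp [dEE, dEO, dOO, dActE, dActO, Finset.sum_add_distrib] <;> abel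
  map_smul' a c := by
    funext q₀ q₁ g h
    rcases q₀ with _ | _ | k <;> rcases q₁ with _ | _ | l <;>
      simp [dEE, dEO, dOO, dActE, dActO, Finset.smul_sum, smul_comm a]

/-- The space `Z^q(𝔤; 𝔤)` of `q`-cocycles. -/
def cocycles (q : ℕ) : Submodule K 𝔤.RawCochain :=
  𝔤.cochains q ⊓ LinearMap.ker 𝔤.d

/-- The space `B^q(𝔤; 𝔤) = d C^{q-1}(𝔤; 𝔤)` of `q`-coboundaries, with `B^0 = 0`. -/
def coboundaries : ℕ → Submodule K 𝔤.RawCochain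
  | 0 => ⊥
  | q + 1 => (𝔤.cochains q).map 𝔤.d

/-- The adjoint cohomology `H^q(𝔤; 𝔤) = Z^q(𝔤; 𝔤) / B^q(𝔤; 𝔤)` (even and odd classes together). -/
abbrev Cohomology (q : ℕ) : Type _ :=
  𝔤.cocycles q ⧸ (𝔤.coboundaries q).submoduleOf (𝔤.cocycles q)

/-- A Lie superalgebra is complete if its adjoint cohomology vanishes in degrees `0`, `1`, `2`. -/
def IsComplete : Prop :=
  ∀ i : ℕ, i ≤ 2 → Subsingleton (𝔤.Cohomology i)

end LieSuperalgebra

/-- The index set of the basis `X₁, …, X_n, T₁, T₂, T₃, Y₁, …, Y_m`; the element `X i` is `X_{i+1}` in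
the usual numbering, and `Y j` is `Y_{j+1}`. -/
inductive SLIndex (n m : ℕ) : Type
  | X (i : Fin n)
  | T1
  | T2
  | T3
  | Y (j : Fin m)
  deriving DecidableEq, Fintype

namespace SLIndex

variable {n m : ℕ}

/-- The parity of a basis vector: `X_i` and `T_k` are even, `Y_j` is odd. -/
def parity : SLIndex n m → ZMod 2
  | Y _ => 1
  | _ => 0

/-- The listed brackets `[X₁, X_i] = X_{i+1}` for `2 ≤ i ≤ n - 1`, `[X₁, Y_j] = Y_{j+1}` for
`1 ≤ j ≤ m - 1`, `[T₁, X_i] = i X_i`, `[T₁, Y_j] = j Y_j`, `[T₂, X_i] = X_i` for `2 ≤ i`,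
`[T₃, Y_j] = Y_j`; all other values are `0`. -/
def listed (K : Type*) [Field K] : SLIndex n m → SLIndex n m → (SLIndex n m → K)
  | X i, X j =>
      if h : i.val = 0 ∧ 1 ≤ j.val ∧ j.val + 1 < n then
        Pi.single (X ⟨j.val + 1, h.2.2⟩) 1 else 0
  | X i, Y j =>
      if h : i.val = 0 ∧ j.val + 1 < m then Pi.single (Y ⟨j.val + 1, h.2⟩) 1 else 0
  | T1, X i => Pi.single (X i) ((i.val + 1 : ℕ) : K)
  | T1, Y j => Pi.single (Y j) ((j.val + 1 : ℕ) : K)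
  | T2, X i => if 1 ≤ i.val then Pi.single (X i) 1 else 0
  | T3, Y j => Pi.single (Y j) 1
  | _, _ => 0

/-- The bracket of two basis vectors. At most one of `[a, b]`, `[b, a]` is listed, and then `a` or `b`
is even, so that `[b, a] = -[a, b]`. -/
def table (K : Type*) [Field K] (a b : SLIndex n m) : SLIndex n m → K :=
  listed K a b - listed K b a

/-- The bracket of `SL^{n,m}`, the bilinear extension of the brackets of the basis vectors. -/
noncomputable def br (K : Type*) [Field K] (n m : ℕ) :
    (SLIndex n m → K) →ₗ[K] (SLIndex n m → K) →ₗ[K] (SLIndex n m → K) :=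
  (Pi.basisFun K (SLIndex n m)).constr K fun a =>
    (Pi.basisFun K (SLIndex n m)).constr K fun b => table K a b

theorem br_single (K : Type*) [Field K] (a b : SLIndex n m) :
    br K n m (Pi.single a 1) (Pi.single b 1) = table K a b := by
  rw [br, ← Pi.basisFun_apply, ← Pi.basisFun_apply, Module.Basis.constr_basis,
    Module.Basis.constr_basis]

theorem br_apply (K : Type*) [Field K] (x y : SLIndex n m → K) (c : SLIndex n m) :
    br K n m x y c = ∑ a, ∑ b, x a * (y b * table K a b c) := by
  simp [br, Module.Basis.constr_apply_fintype, Finset.sum_apply, Finset.mul_sum]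

theorem table_skew (K : Type*) [Field K] (a b : SLIndex n m) : table K a b = -table K b a := by
  simp [table]

theorem table_parity (K : Type*) [Field K] (a b c : SLIndex n m)
    (h : parity c ≠ parity a + parity b) : table K a b c = 0 := by
  rcases a with i | _ | _ | _ | i <;> rcases b with j | _ | _ | _ | j <;>
    rcases c with k | _ | _ | _ | k <;> simp_all [parity, table, listed] <;>
    split_ifs <;> simp_all

theorem table_odd (K : Type*) [Field K] (a b : SLIndex n m)
    (ha : parity a = 1) (hb : parity b = 1) : table K a b = 0 := by
  rcases a with i | _ | _ | _ | i <;> rcases b with j | _ | _ | _ | j <;>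
    simp_all [parity, table, listed]

theorem br_skew (K : Type*) [Field K] (x y : SLIndex n m → K) :
    br K n m x y = -br K n m y x := by
  ext c
  rw [Pi.neg_apply, br_apply, br_apply, Finset.sum_comm, ← Finset.sum_neg_distrib]
  refine Finset.sum_congr rfl fun b _ => ?_
  rw [← Finset.sum_neg_distrib]
  refine Finset.sum_congr rfl fun a _ => ?_
  rw [table_skew, Pi.neg_apply]; ring

theorem br_single_right (K : Type*) [Field K] (a b : SLIndex n m) (r : K) :
    br K n m (Pi.single a 1) (Pi.single b r) = r • table K a b := by
  rw [← br_single, ← map_smul, ← Pi.single_smul, smul_eq_mul, mul_one]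

theorem basis_induction (K : Type*) [Field K] {P : (SLIndex n m → K) → Prop} (h0 : P 0)
    (hadd : ∀ x y, P x → P y → P (x + y)) (hsmul : ∀ (r : K) x, P x → P (r • x))
    (hb : ∀ a, P (Pi.single a 1)) (x : SLIndex n m → K) : P x := by
  rw [← (Pi.basisFun K (SLIndex n m)).sum_repr x]
  exact Finset.sum_induction _ P hadd h0 fun a _ => hsmul _ _ (by simpa using hb a)

theorem table_jacobi_torus (K : Type*) [Field K] (t : SLIndex n m) (ht : t = T1 ∨ t = T2 ∨ t = T3)
    (b c : SLIndex n m) :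
    br K n m (Pi.single t 1) (table K b c) + br K n m (Pi.single b 1) (table K c t)
      + br K n m (Pi.single c 1) (table K t b) = 0 := by
  obtain ⟨w, hw, hw'⟩ : ∃ w : SLIndex n m → K, (∀ b, table K t b = Pi.single b (w b)) ∧
      ∀ b c, br K n m (Pi.single t 1) (table K b c) = (w b + w c) • table K b c := by
    have skew : ∀ w : SLIndex n m → K,
        (∀ b c, br K n m (Pi.single t 1) (listed K b c) = (w b + w c) • listed K b c) →
        ∀ b c, br K n m (Pi.single t 1) (table K b c) = (w b + w c) • table K b c := by
      intro w h b c
      rw [table, map_sub, h, h, smul_sub, add_comm (w c)]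
    rcases ht with rfl | rfl | rfl
    · refine ⟨fun | X i => ((i.val + 1 : ℕ) : K) | Y j => ((j.val + 1 : ℕ) : K) | _ => 0, ?_,
        skew _ ?_⟩
      · rintro (_ | _ | _ | _ | _) <;> simp [table, listed]
      · rintro (i | _ | _ | _ | i) (j | _ | _ | _ | j) <;> simp only [listed] <;>
          (try split_ifs) <;> simp [br_single_right, table, listed, ← Pi.single_smul] <;>
          first | grind | (rename_i h; simp only [h.1, Nat.cast_zero]; ring)
    · refine ⟨fun | X i => if 1 ≤ i.val then 1 else 0 | _ => 0, ?_, skew _ ?_⟩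
      · rintro (_ | _ | _ | _ | _) <;> simp [table, listed] <;> split_ifs <;> simp
      · rintro (i | _ | _ | _ | i) (j | _ | _ | _ | j) <;> simp only [listed] <;>
          (try split_ifs) <;> simp [br_single_right, table, listed, ← Pi.single_smul] <;> grind
    · refine ⟨fun | Y _ => 1 | _ => 0, ?_, skew _ ?_⟩
      · rintro (_ | _ | _ | _ | _) <;> simp [table, listed]
      · rintro (i | _ | _ | _ | i) (j | _ | _ | _ | j) <;> simp only [listed] <;>
          (try split_ifs) <;> simp [br_single_right, table, listed, ← Pi.single_smul]
  rw [hw', hw, table_skew K c t, hw, map_neg, br_single_right, br_single_right, table_skew K c b,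
    add_smul, smul_neg]
  abel

theorem table_eq_zero (K : Type*) [Field K] (a b : SLIndex n m)
    (ha : ¬ (a = T1 ∨ a = T2 ∨ a = T3)) (hb : ¬ (b = T1 ∨ b = T2 ∨ b = T3))
    (ha' : ∀ i : Fin n, i.val = 0 → a ≠ X i) (hb' : ∀ i : Fin n, i.val = 0 → b ≠ X i) :
    table K a b = 0 := by
  rcases a with i | _ | _ | _ | i <;> rcases b with j | _ | _ | _ | j <;> simp at ha hb
  · have hi : i.val ≠ 0 := fun h => ha' i h rfl
    have hj : j.val ≠ 0 := fun h => hb' j h rfl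
    simp [table, listed, hi, hj]
  · have hi : i.val ≠ 0 := fun h => ha' i h rfl
    simp [table, listed, hi]
  · have hj : j.val ≠ 0 := fun h => hb' j h rfl
    simp [table, listed, hj]
  · simp [table, listed]

theorem br_table_eq_zero (K : Type*) [Field K] (a b c : SLIndex n m)
    (ha : ¬ (a = T1 ∨ a = T2 ∨ a = T3)) (hb : ¬ (b = T1 ∨ b = T2 ∨ b = T3))
    (hc : ¬ (c = T1 ∨ c = T2 ∨ c = T3)) (ha' : ∀ i : Fin n, i.val = 0 → a ≠ X i) :
    br K n m (Pi.single a 1) (table K b c) = 0 := by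
  have H : ∀ b c : SLIndex n m, ¬ (b = T1 ∨ b = T2 ∨ b = T3) → ¬ (c = T1 ∨ c = T2 ∨ c = T3) →
      br K n m (Pi.single a 1) (listed K b c) = 0 := by
    intro b c hb hc
    rcases b with j | _ | _ | _ | j <;> rcases c with k | _ | _ | _ | k <;> simp at hb hc <;>
      simp only [listed, map_zero]
    all_goals
      split_ifs
      · rw [br_single_right, table_eq_zero K a _ ha (by simp) ha' (by
          rintro i hi ⟨⟩; try simp at hi), smul_zero]
      · simp
  rw [table, map_sub, H b c hb hc, H c b hc hb, sub_zero]

theorem table_jacobi (K : Type*) [Field K] (a b c : SLIndex n m) :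
    br K n m (Pi.single a 1) (table K b c) + br K n m (Pi.single b 1) (table K c a)
      + br K n m (Pi.single c 1) (table K a b) = 0 := by
  by_cases ha : a = T1 ∨ a = T2 ∨ a = T3
  · exact table_jacobi_torus K a ha b c
  by_cases hb : b = T1 ∨ b = T2 ∨ b = T3
  · rw [← table_jacobi_torus K b hb c a]; abel
  by_cases hc : c = T1 ∨ c = T2 ∨ c = T3
  · rw [← table_jacobi_torus K c hc a b]; abel
  have self : ∀ a : SLIndex n m, table K a a = 0 := fun a => sub_self _
  have rep : ∀ a c : SLIndex n m, br K n m (Pi.single a 1) (table K a c)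
      + br K n m (Pi.single a 1) (table K c a) = 0 := by
    intro a c
    rw [table_skew K c a, map_neg, add_neg_cancel]
  by_cases ha' : ∀ i : Fin n, i.val = 0 → a ≠ X i
  · rw [br_table_eq_zero K a b c ha hb hc ha', zero_add]
    by_cases hb' : ∀ i : Fin n, i.val = 0 → b ≠ X i
    · rw [br_table_eq_zero K b c a hb hc ha hb', table_eq_zero K a b ha hb ha' hb', map_zero,
        add_zero]
    by_cases hc' : ∀ i : Fin n, i.val = 0 → c ≠ X i
    · rw [br_table_eq_zero K c a b hc ha hb hc', table_eq_zero K c a hc ha hc' ha', map_zero,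
        add_zero]
    push Not at hb' hc'
    obtain ⟨i, hi, rfl⟩ := hb'
    obtain ⟨k, hk, rfl⟩ := hc'
    obtain rfl : i = k := Fin.ext (hi.trans hk.symm)
    exact rep _ _
  by_cases hb' : ∀ i : Fin n, i.val = 0 → b ≠ X i
  · rw [br_table_eq_zero K b c a hb hc ha hb', add_zero]
    by_cases hc' : ∀ i : Fin n, i.val = 0 → c ≠ X i
    · rw [br_table_eq_zero K c a b hc ha hb hc', table_eq_zero K b c hb hc hb' hc', map_zero,
        add_zero]
    push Not at ha' hc'
    obtain ⟨i, hi, rfl⟩ := ha'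
    obtain ⟨k, hk, rfl⟩ := hc'
    obtain rfl : i = k := Fin.ext (hi.trans hk.symm)
    rw [add_comm]; exact rep _ _
  push Not at ha' hb'
  obtain ⟨i, hi, rfl⟩ := ha'
  obtain ⟨k, hk, rfl⟩ := hb'
  obtain rfl : i = k := Fin.ext (hi.trans hk.symm)
  rw [self, map_zero, add_zero]; exact rep _ _

theorem br_jacobi (K : Type*) [Field K] (x y z : SLIndex n m → K) :
    br K n m x (br K n m y z) + br K n m y (br K n m z x) + br K n m z (br K n m x y) = 0 := by
  have add3 : ∀ p q r p' q' r' : SLIndex n m → K, p + q + r = 0 → p' + q' + r' = 0 →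
      p + p' + (q + q') + (r + r') = 0 := by
    intro p q r p' q' r' h h'
    calc _ = (p + q + r) + (p' + q' + r') := by abel
      _ = 0 := by rw [h, h', add_zero]
  induction x using basis_induction K with
  | h0 => simp
  | hadd x x' hx hx' => simpa only [map_add, LinearMap.add_apply] using add3 _ _ _ _ _ _ hx hx'
  | hsmul r x hx =>
    simpa only [map_smul, LinearMap.smul_apply, ← smul_add, smul_zero] using congrArg (r • ·) hx
  | hb a =>
  induction y using basis_induction K with
  | h0 => simp
  | hadd x x' hx hx' => simpa only [map_add, LinearMap.add_apply] using add3 _ _ _ _ _ _ hx hx'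
  | hsmul r x hx =>
    simpa only [map_smul, LinearMap.smul_apply, ← smul_add, smul_zero] using congrArg (r • ·) hx
  | hb b =>
  induction z using basis_induction K with
  | h0 => simp
  | hadd x x' hx hx' => simpa only [map_add, LinearMap.add_apply] using add3 _ _ _ _ _ _ hx hx'
  | hsmul r x hx =>
    simpa only [map_smul, LinearMap.smul_apply, ← smul_add, smul_zero] using congrArg (r • ·) hx
  | hb c => simpa only [br_single] using table_jacobi K a b c

theorem br_odd (K : Type*) [Field K] (x y : SLIndex n m → K)
    (hx : ∀ a, parity a ≠ 1 → x a = 0) (hy : ∀ a, parity a ≠ 1 → y a = 0) :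
    br K n m x y = 0 := by
  ext c
  rw [br_apply]
  refine Finset.sum_eq_zero fun a _ => Finset.sum_eq_zero fun b _ => ?_
  by_cases ha : parity a = 1
  · by_cases hb : parity b = 1
    · rw [table_odd K a b ha hb]; simp
    · rw [hy b hb]; simp
  · rw [hx a ha]; simp

theorem br_parity (K : Type*) [Field K] (α β : ZMod 2) (x y : SLIndex n m → K)
    (hx : ∀ a, parity a ≠ α → x a = 0) (hy : ∀ a, parity a ≠ β → y a = 0) :
    ∀ c, parity c ≠ α + β → br K n m x y c = 0 := by
  intro c hc
  rw [br_apply]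
  refine Finset.sum_eq_zero fun a _ => Finset.sum_eq_zero fun b _ => ?_
  by_cases ha : parity a = α
  · by_cases hb : parity b = β
    · rw [table_parity K a b c (by rw [ha, hb]; exact hc)]; simp
    · rw [hy b hb]; simp
  · rw [hx a ha]; simp

end SLIndex

/-- The Lie superalgebra `SL^{n,m}` over `K`, on the space of coordinate vectors with respect to the
basis `X₁, …, X_n, T₁, T₂, T₃, Y₁, …, Y_m`. -/
noncomputable def SL (K : Type*) [Field K] (n m : ℕ) : LieSuperalgebra K (SLIndex n m → K) where
  part α :=
    { carrier := {x | ∀ a, SLIndex.parity a ≠ α → x a = 0}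
      zero_mem' := fun _ _ => rfl
      add_mem' := fun hx hy a ha => by simp [hx a ha, hy a ha]
      smul_mem' := fun r x hx a ha => by simp [hx a ha] }
  isCompl := by
    refine IsCompl.of_eq ?_ ?_
    · rw [Submodule.eq_bot_iff]
      rintro x ⟨h₀, h₁⟩
      funext a
      by_cases ha : SLIndex.parity a = 0
      · exact h₁ a (by rw [ha]; decide)
      · exact h₀ a ha
    · rw [Submodule.eq_top_iff']
      intro x
      refine Submodule.mem_sup.2 ⟨fun a => if SLIndex.parity a = 0 then x a else 0, ?_,
        fun a => if SLIndex.parity a = 0 then 0 else x a, ?_, ?_⟩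
      · intro a ha
        simp [ha]
      · intro a ha
        have : SLIndex.parity a = 0 := by revert ha; generalize SLIndex.parity a = p; revert p; decide
        simp [this]
      · funext a
        by_cases ha : SLIndex.parity a = 0 <;> simp [ha]
  bracket := SLIndex.br K n m
  bracket_mem α β x y hx hy := SLIndex.br_parity K α β x y hx hy
  bracket_skew α β x y hx hy := by
    have hp : ∀ a : ZMod 2, a = 0 ∨ a = 1 := by decide
    rcases hp α with rfl | rfl <;> rcases hp β with rfl | rfl
    · simpa [ZMod.val_one] using SLIndex.br_skew K x y
    · simpa [ZMod.val_one] using SLIndex.br_skew K x y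
    · simpa [ZMod.val_one] using SLIndex.br_skew K x y
    · simp [SLIndex.br_odd K x y hx hy, SLIndex.br_odd K y x hy hx]
  jacobi α β γ x y z hx hy hz := by
    have hp : ∀ a : ZMod 2, a = 0 ∨ a = 1 := by decide
    have J := SLIndex.br_jacobi K x y z
    have hxy := SLIndex.br_parity K α β x y hx hy
    have hyz := SLIndex.br_parity K β γ y z hy hz
    have hzx := SLIndex.br_parity K γ α z x hz hx
    rcases hp α with rfl | rfl <;> rcases hp β with rfl | rfl <;> rcases hp γ with rfl | rfl
    · simpa [ZMod.val_one] using J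
    · simpa [ZMod.val_one] using J
    · simpa [ZMod.val_one] using J
    · simp [SLIndex.br_odd K y z hy hz, SLIndex.br_odd K y _ hy hzx, SLIndex.br_odd K z _ hz hxy]
    · simpa [ZMod.val_one] using J
    · simp [SLIndex.br_odd K z x hz hx, SLIndex.br_odd K x _ hx hyz, SLIndex.br_odd K z _ hz hxy]
    · simp [SLIndex.br_odd K x y hx hy, SLIndex.br_odd K x _ hx hyz, SLIndex.br_odd K y _ hy hzx]
    · simp [SLIndex.br_odd K x y hx hy, SLIndex.br_odd K y z hy hz, SLIndex.br_odd K z x hz hx]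

/-! ### The differential in low degrees. -/

namespace LieSuperalgebra

variable {K L : Type*} [Field K] [AddCommGroup L] [Module K L] (𝔤 : LieSuperalgebra K L)

/-! The torus spanned by T₁, T₂, T₃ acts diagonally, and contraction with a torus element t is a
homotopy: for a cocycle c, the Lie derivative of c along t is the coboundary of the contraction of c
with t. On a component of c of non-zero t-weight the Lie derivative is multiplication by a non-zero
integer, which can be divided by in characteristic zero. So every cocycle is cohomologous to one of
t-weight zero (`exists_cob_height`, and the first half of `exists_inner`).

The element t = `generic K n m` is chosen with widely spaced integer eigenvalues (`height`): they
separate the basis vectors outside the torus, and a sum of two non-zero eigenvalues is an eigenvalue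
only for the brackets [X₁, b] = d. A weight-zero cochain is therefore described by a few scalars. In
degree 1 it multiplies each root vector b by α(b), and the cocycle identity makes α additive along b
↦ [X₁, b]. Since the torus weights of X₁, X₂, Y₁ form a basis of K³, such an α is the action of a
torus element (`exists_torus_of_additive`), that is, an inner derivation. In degree 2 the values on
(T_k, b) are absorbed in the same way, those on (X₁, b) are increments along the strings X₂, …, X_n
and Y₁, …, Y_m and are absorbed by a diagonal map (`exists_of_increments`), and the values on pairs
of torus elements vanish because the torus acts faithfully. In degree 0, an element of the centre
has weight zero, hence lies in the torus, hence vanishes by faithfulness.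

Odd elements bracket to zero, so `br` is also an ordinary Lie bracket on the whole space. The super
signs matter only for 2-cochains on two odd arguments, and there no component of weight zero exists.
-/

theorem d_one_zero (c : 𝔤.RawCochain) (x : 𝔤.part 0) :
    𝔤.d c 1 0 ![x] ![] = -𝔤.bracket x (c 0 0 ![] ![]) := by
  simp [d, dEE, dEO, dOO, dActE, dActO]

theorem d_zero_one (c : 𝔤.RawCochain) (y : 𝔤.part 1) :
    𝔤.d c 0 1 ![] ![y] = -𝔤.bracket y (c 0 0 ![] ![]) := by
  simp [d, dEE, dEO, dOO, dActE, dActO]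

/-- The differential produces argument tuples through `Fin.cons` and `removeNth`. Rewriting with a
function of the entries leaves only evaluations at single indices, so the tuples never have to be
normalised. -/
theorem exists_eval_one_zero (c : 𝔤.RawCochain) :
    ∃ A : 𝔤.part 0 → L, ∀ g h, c 1 0 g h = A (g 0) :=
  ⟨fun x => c 1 0 ![x] ![], fun g h => by congr 1 <;> ext i <;> fin_cases i <;> rfl⟩

theorem exists_eval_zero_one (c : 𝔤.RawCochain) :
    ∃ A : 𝔤.part 1 → L, ∀ g h, c 0 1 g h = A (h 0) :=
  ⟨fun x => c 0 1 ![] ![x], fun g h => by congr 1 <;> ext i <;> fin_cases i <;> rfl⟩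

theorem exists_eval_two_zero (c : 𝔤.RawCochain) :
    ∃ A : 𝔤.part 0 → 𝔤.part 0 → L, ∀ g h, c 2 0 g h = A (g 0) (g 1) :=
  ⟨fun x y => c 2 0 ![x, y] ![], fun g h => by congr 1 <;> ext i <;> fin_cases i <;> rfl⟩

theorem exists_eval_one_one (c : 𝔤.RawCochain) :
    ∃ A : 𝔤.part 0 → 𝔤.part 1 → L, ∀ g h, c 1 1 g h = A (g 0) (h 0) :=
  ⟨fun x y => c 1 1 ![x] ![y], fun g h => by congr 1 <;> ext i <;> fin_cases i <;> rfl⟩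

theorem exists_eval_zero_two (c : 𝔤.RawCochain) :
    ∃ A : 𝔤.part 1 → 𝔤.part 1 → L, ∀ g h, c 0 2 g h = A (h 0) (h 1) :=
  ⟨fun x y => c 0 2 ![] ![x, y], fun g h => by congr 1 <;> ext i <;> fin_cases i <;> rfl⟩

theorem d_two_zero (c : 𝔤.RawCochain) (x y : 𝔤.part 0) :
    𝔤.d c 2 0 ![x, y] ![] = c 1 0 ![𝔤.brEE x y] ![] - 𝔤.bracket x (c 1 0 ![y] ![])
      + 𝔤.bracket y (c 1 0 ![x] ![]) := by
  obtain ⟨A, hA⟩ := 𝔤.exists_eval_one_zero c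
  simp [d, dEE, dEO, dOO, dActE, dActO, Finset.sum_filter, Fin.sum_univ_succ, Fin.removeNth, hA]
  abel

theorem d_one_one (c : 𝔤.RawCochain) (x : 𝔤.part 0) (y : 𝔤.part 1) :
    𝔤.d c 1 1 ![x] ![y] = c 0 1 ![] ![𝔤.brEO x y] - 𝔤.bracket x (c 0 1 ![] ![y])
      + 𝔤.bracket y (c 1 0 ![x] ![]) := by
  obtain ⟨A, hA⟩ := 𝔤.exists_eval_one_zero c
  obtain ⟨B, hB⟩ := 𝔤.exists_eval_zero_one c
  simp [d, dEE, dEO, dOO, dActE, dActO, hA, hB]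
  abel

theorem d_zero_two (c : 𝔤.RawCochain) (x y : 𝔤.part 1) :
    𝔤.d c 0 2 ![] ![x, y] = c 1 0 ![𝔤.brOO x y] ![] - 𝔤.bracket x (c 0 1 ![] ![y])
      - 𝔤.bracket y (c 0 1 ![] ![x]) := by
  obtain ⟨A, hA⟩ := 𝔤.exists_eval_one_zero c
  obtain ⟨B, hB⟩ := 𝔤.exists_eval_zero_one c
  simp [d, dEE, dEO, dOO, dActE, dActO, Finset.sum_filter, Fin.sum_univ_succ, Fin.removeNth, hA, hB]
  abel

theorem d_three_zero (c : 𝔤.RawCochain) (x y z : 𝔤.part 0) :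
    𝔤.d c 3 0 ![x, y, z] ![] = c 2 0 ![𝔤.brEE x y, z] ![] - c 2 0 ![𝔤.brEE x z, y] ![]
      + c 2 0 ![𝔤.brEE y z, x] ![] - 𝔤.bracket x (c 2 0 ![y, z] ![])
      + 𝔤.bracket y (c 2 0 ![x, z] ![]) - 𝔤.bracket z (c 2 0 ![x, y] ![]) := by
  obtain ⟨A, hA⟩ := 𝔤.exists_eval_two_zero c
  simp [d, dEE, dEO, dOO, dActE, dActO, Finset.sum_filter, Fin.sum_univ_succ, Fin.removeNth, hA]
  module

theorem d_two_one (c : 𝔤.RawCochain) (x y : 𝔤.part 0) (z : 𝔤.part 1) :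
    𝔤.d c 2 1 ![x, y] ![z] = c 1 1 ![𝔤.brEE x y] ![z] + c 1 1 ![y] ![𝔤.brEO x z]
      - c 1 1 ![x] ![𝔤.brEO y z] - 𝔤.bracket x (c 1 1 ![y] ![z])
      + 𝔤.bracket y (c 1 1 ![x] ![z]) - 𝔤.bracket z (c 2 0 ![x, y] ![]) := by
  obtain ⟨A, hA⟩ := 𝔤.exists_eval_two_zero c
  obtain ⟨B, hB⟩ := 𝔤.exists_eval_one_one c
  simp [d, dEE, dEO, dOO, dActE, dActO, Finset.sum_filter, Fin.sum_univ_succ, Fin.removeNth, hA, hB]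
  module

theorem d_one_two (c : 𝔤.RawCochain) (x : 𝔤.part 0) (y z : 𝔤.part 1) :
    𝔤.d c 1 2 ![x] ![y, z] = c 0 2 ![] ![𝔤.brEO x y, z] + c 0 2 ![] ![𝔤.brEO x z, y]
      + c 2 0 ![𝔤.brOO y z, x] ![] - 𝔤.bracket x (c 0 2 ![] ![y, z])
      + 𝔤.bracket y (c 1 1 ![x] ![z]) + 𝔤.bracket z (c 1 1 ![x] ![y]) := by
  obtain ⟨A, hA⟩ := 𝔤.exists_eval_two_zero c
  obtain ⟨B, hB⟩ := 𝔤.exists_eval_one_one c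
  obtain ⟨C, hC⟩ := 𝔤.exists_eval_zero_two c
  simp [d, dEE, dEO, dOO, dActE, dActO, Finset.sum_filter, Fin.sum_univ_succ, Fin.removeNth, hA, hB,
    hC]
  module

/-- Each of the five terms raises the total degree by exactly one. Raw cochains have components in
all bidegrees, so an equality with a coboundary also has to be checked away from the expected
degree. -/
theorem d_apply_eq_zero {q : ℕ} {c : 𝔤.RawCochain} (hc : c ∈ 𝔤.cochains q) {q₀ q₁ : ℕ}
    (h : q₀ + q₁ ≠ q + 1) : 𝔤.d c q₀ q₁ = 0 := by
  have h0 : ∀ a b, a + b ≠ q → ∀ x y, c a b x y = 0 := fun a b hab x y => by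
    rw [hc.2 a b hab]; rfl
  funext g k
  rcases q₀ with _ | _ | q₀ <;> rcases q₁ with _ | _ | q₁ <;>
    simp [d, dEE, dEO, dOO, dActE, dActO] <;> simp (disch := omega) [h0]

end LieSuperalgebra

/-! ### Torus weights and a generic grading. -/

namespace SLIndex

variable {n m : ℕ} {K : Type*} [Field K]

/-- The weights of the basis vectors with respect to `T₁`, `T₂`, `T₃`. -/
def weight : Fin 3 → SLIndex n m → ℕ
  | 0, X i => i.val + 1
  | 0, Y j => j.val + 1
  | 1, X i => if 1 ≤ i.val then 1 else 0
  | 2, Y _ => 1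
  | _, _ => 0

/-- The basis vectors `T₁`, `T₂`, `T₃` of the torus. -/
def torus : Fin 3 → SLIndex n m := ![T1, T2, T3]

theorem table_torus (k : Fin 3) (a : SLIndex n m) :
    table K (torus k) a = (weight k a : K) • Pi.single a 1 := by
  fin_cases k <;> rcases a with i | _ | _ | _ | i <;>
    simp [table, listed, torus, weight, ← Pi.single_smul]

theorem weight_torus (k l : Fin 3) : weight k (torus l : SLIndex n m) = 0 := by
  fin_cases k <;> fin_cases l <;> rfl

/-- Each T_k acts as a derivation, so the bracket is graded by its weights. Stated in ℕ through
non-zero structure constants, this is independent of the characteristic. -/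
theorem weight_add {a b d : SLIndex n m} (h : table K a b d ≠ 0) (k : Fin 3) :
    weight k a + weight k b = weight k d := by
  have key : ∀ a b d : SLIndex n m, listed K a b d ≠ 0 →
      weight k a + weight k b = weight k d := by
    intro a b d h
    rcases a with i | _ | _ | _ | i <;> rcases b with j | _ | _ | _ | j <;>
      simp only [listed, Pi.zero_apply, ne_eq, not_true_eq_false] at h <;>
      (try split_ifs at h) <;>
      (try simp only [Pi.zero_apply, not_true_eq_false] at h) <;>
      rcases d with l | _ | _ | _ | l <;>
      simp [Pi.single_apply] at h <;> fin_cases k <;> simp [weight, h] <;> grind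
  by_cases h₁ : listed K a b d = 0
  · rw [add_comm]
    exact key b a d fun h₂ => h (by simp [table, h₁, h₂])
  · exact key a b d h₁

/-- The weights of the basis vectors with respect to a generic element of the torus. -/
def height (a : SLIndex n m) : ℕ :=
  weight 0 a + 4 * (n + m + 2) * weight 1 a + 16 * (n + m + 2) * weight 2 a

theorem height_add {a b d : SLIndex n m} (h : table K a b d ≠ 0) :
    height a + height b = height d := by
  simp only [height, ← weight_add h]
  ring

/-- A generic element of the torus. -/
def generic (K : Type*) [Field K] (n m : ℕ) : SLIndex n m → K :=
  Pi.single T1 1 + (4 * (n + m + 2) : ℕ) • Pi.single T2 1 + (16 * (n + m + 2) : ℕ) • Pi.single T3 1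

theorem br_generic (a : SLIndex n m) :
    br K n m (generic K n m) (Pi.single a 1) = (height a : K) • Pi.single a 1 := by
  have h1 := table_torus (K := K) 0 a
  have h2 := table_torus (K := K) 1 a
  have h3 := table_torus (K := K) 2 a
  simp only [torus, Matrix.cons_val] at h1 h2 h3
  simp only [generic, map_add, LinearMap.add_apply, map_nsmul, LinearMap.smul_apply, br_single, h1,
    h2, h3, height]
  push_cast
  module

theorem br_single_apply (a d : SLIndex n m) (v : SLIndex n m → K) :
    br K n m (Pi.single a 1) v d = ∑ b, v b * table K a b d := by
  simp [br_apply, Pi.single_apply]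

theorem br_generic_apply (v : SLIndex n m → K) (d : SLIndex n m) :
    br K n m (generic K n m) v d = height d * v d := by
  induction v using basis_induction K with
  | h0 => simp
  | hadd x y hx hy => simp [hx, hy, mul_add]
  | hsmul r x hx => simp [hx]; ring
  | hb a =>
    rw [br_generic]
    by_cases h : d = a
    · simp [h]
    · simp [h]

/-- With N = n + m + 2 and the usual numbering, the heights are 0 on the torus, 1 for X₁, 4N + i for
X_i with i ≥ 2, and 16N + j for Y_j, where i, j < N. The multiples 8N, 20N, 32N arising from sums of
two of the larger heights fall into gaps, and 1 + 1 is not a height. The facts on heights below are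
this arithmetic. -/
theorem height_X (i : Fin n) :
    height (X i : SLIndex n m) = i.val + 1 + if 1 ≤ i.val then 4 * (n + m + 2) else 0 := by
  simp only [height, weight]
  split_ifs <;> simp

theorem height_Y (j : Fin m) :
    height (Y j : SLIndex n m) = j.val + 1 + 16 * (n + m + 2) := by
  simp [height, weight]

theorem height_T1 : height (T1 : SLIndex n m) = 0 := by simp [height, weight]
theorem height_T2 : height (T2 : SLIndex n m) = 0 := by simp [height, weight]
theorem height_T3 : height (T3 : SLIndex n m) = 0 := by simp [height, weight]

/-- Distinct basis vectors outside the torus have distinct non-zero heights. -/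
theorem height_injOn {a b : SLIndex n m} (h : height a = height b) (hb : height b ≠ 0) : a = b := by
  rcases a with i | _ | _ | _ | i <;> rcases b with j | _ | _ | _ | j <;>
    simp only [height_X, height_Y, height_T1, height_T2, height_T3] at h hb <;>
    (try split_ifs at h) <;> first | omega | (congr 1; ext; omega)

theorem eq_torus_of_height {a : SLIndex n m} (h : height a = 0) : ∃ k, a = torus k := by
  rcases a with i | _ | _ | _ | i
  · simp [height_X] at h
  · exact ⟨0, rfl⟩
  · exact ⟨1, rfl⟩
  · exact ⟨2, rfl⟩
  · simp [height_Y] at h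

theorem height_torus (k : Fin 3) : height (torus k : SLIndex n m) = 0 := by
  simp [height, weight_torus]

/-- The only sums of heights outside the torus that are heights come from `X₁`. -/
theorem height_add_eq {a b d : SLIndex n m} (h : height a + height b = height d)
    (ha : height a ≠ 0) (hb : height b ≠ 0) :
    (height a = 1 ∧ height b ≠ 1) ∨ (height b = 1 ∧ height a ≠ 1) := by
  rcases a with i | _ | _ | _ | i <;> rcases b with j | _ | _ | _ | j <;>
    rcases d with l | _ | _ | _ | l <;>
    simp only [height_X, height_Y, height_T1, height_T2, height_T3] at h ha hb ⊢ <;>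
    (try split_ifs at h ⊢) <;> omega

/-- A converse to `height_add`: adding the height of X₁ moves one step along a string, and all
brackets [X₁, b] along the strings have coefficient 1. -/
theorem table_of_height {a b d : SLIndex n m} (h : height a + height b = height d)
    (ha : height a = 1) (hb : height b ≠ 0) (hb1 : height b ≠ 1) :
    table K a b = Pi.single d 1 := by
  rcases a with i | _ | _ | _ | i <;> rcases b with j | _ | _ | _ | j <;>
    rcases d with l | _ | _ | _ | l <;>
    simp only [height_X, height_Y, height_T1, height_T2, height_T3] at h ha hb hb1 <;>
    (try split_ifs at h ha hb hb1) <;> first | omega | skip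
  · have hl : l.val = j.val + 1 := by omega
    have : i.val = 0 ∧ 1 ≤ j.val ∧ j.val + 1 < n := by omega
    simp [table, listed, this, ← hl]
  · have hl : l.val = j.val + 1 := by omega
    have : i.val = 0 ∧ j.val + 1 < m := by omega
    simp [table, listed, this, ← hl]

/-! ### Linear algebra on the torus and along the strings. -/

theorem apply_eq_sum (f : (SLIndex n m → K) →ₗ[K] SLIndex n m → K) (v : SLIndex n m → K)
    (d : SLIndex n m) : f v d = ∑ a, v a * f (Pi.single a 1) d := by
  conv_lhs => rw [← (Pi.basisFun K (SLIndex n m)).sum_repr v]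
  simp

theorem parity_of_height_zero {a : SLIndex n m} (h : height a = 0) : parity a = 0 := by
  rcases a with i | _ | _ | _ | i <;> simp_all [parity, height_Y]

theorem parity_of_height_one {a : SLIndex n m} (h : height a = 1) : parity a = 0 := by
  rcases a with i | _ | _ | _ | i <;> first | rfl | (rw [height_Y] at h; omega)

theorem eq_X_zero_of_height (hn : 2 ≤ n) {a : SLIndex n m} (h : height a = 1) :
    a = X ⟨0, by omega⟩ := by
  rcases a with i | _ | _ | _ | i
  · rw [height_X] at h
    congr 1; ext; simp; split_ifs at h <;> omega
  all_goals simp only [height_T1, height_T2, height_T3, height_Y] at h; omega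

/-- A function on the basis outside the torus that is constant along the strings
`X₂, …, X_n` and `Y₁, …, Y_m` vanishes if it vanishes at `X₁`, `X₂`, `Y₁`. -/
theorem eq_zero_of_strings (hn : 2 ≤ n) (hm : 1 ≤ m) (ψ : SLIndex n m → K)
    (h1 : ψ (X ⟨0, by omega⟩) = 0) (h2 : ψ (X ⟨1, by omega⟩) = 0) (h3 : ψ (Y ⟨0, by omega⟩) = 0)
    (hs : ∀ b d, height b ≠ 0 → height b ≠ 1 → 1 + height b = height d → ψ d = ψ b)
    (b : SLIndex n m) (hb : height b ≠ 0) : ψ b = 0 := by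
  have hX : ∀ i (hi : i + 1 < n), ψ (X ⟨i + 1, hi⟩) = 0 := by
    intro i
    induction i with
    | zero => exact fun _ => h2
    | succ i ih =>
      intro hi
      rw [hs (X ⟨i + 1, by omega⟩) _ (by simp [height_X]) (by simp [height_X]; omega)
        (by simp [height_X]; ring), ih]
  have hY : ∀ i (hi : i < m), ψ (Y ⟨i, hi⟩) = 0 := by
    intro i
    induction i with
    | zero => exact fun _ => h3
    | succ i ih =>
      intro hi
      rw [hs (Y ⟨i, by omega⟩) _ (by simp [height_Y]) (by simp [height_Y]; omega)
        (by simp [height_Y]; ring), ih]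
  rcases b with ⟨_ | i, hi⟩ | _ | _ | _ | i
  · exact h1
  · exact hX i hi
  · simp [height_T1] at hb
  · simp [height_T2] at hb
  · simp [height_T3] at hb
  · exact hY i i.2

/-- Functions on the basis can be prescribed by their increments along the strings
`X₂, …, X_n` and `Y₁, …, Y_m`. -/
theorem exists_of_increments (g : SLIndex n m → SLIndex n m → K) :
    ∃ f : SLIndex n m → K, (∀ a, height a = 1 → f a = 0) ∧
      ∀ b d, height b ≠ 0 → height b ≠ 1 → 1 + height b = height d → f d = f b + g b d := by
  -- Partial sums of increments. Indices start at 0, and the guard `1 ≤ l` drops the step from X₁ to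
  -- X₂, which is not given by a bracket with X₁; so both strings start with the value 0.
  refine ⟨fun
    | X i => ∑ l ∈ Finset.range i.val,
        if h : 1 ≤ l ∧ l + 1 < n then g (X ⟨l, by omega⟩) (X ⟨l + 1, h.2⟩) else 0
    | Y j => ∑ l ∈ Finset.range j.val,
        if h : l + 1 < m then g (Y ⟨l, by omega⟩) (Y ⟨l + 1, h⟩) else 0
    | _ => 0, ?_, ?_⟩
  · intro a ha
    rcases a with i | _ | _ | _ | i <;> simp only
    · rw [height_X] at ha
      have : i.val = 0 := by split_ifs at ha <;> omega
      simp [this]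
    · rw [height_Y] at ha
      omega
  · intro b d h0 h1 h
    rcases b with j | _ | _ | _ | j <;> rcases d with l | _ | _ | _ | l <;>
      simp only [height_X, height_Y, height_T1, height_T2, height_T3] at h h0 h1 <;>
      (try split_ifs at h h0 h1) <;> first | omega | skip
    · obtain ⟨l, hl'⟩ := l
      obtain rfl : l = j.val + 1 := by simp only at h; omega
      have hj : 1 ≤ j.val ∧ j.val + 1 < n := by omega
      simp [Finset.sum_range_succ, hj]
    · obtain ⟨l, hl'⟩ := l
      obtain rfl : l = j.val + 1 := by simp only at h; omega
      have hj : j.val + 1 < m := by omega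
      simp [Finset.sum_range_succ, hj]

/-- The bracket with an element of the torus. -/
theorem br_of_support_torus (u : SLIndex n m → K) (hu : ∀ d, height d ≠ 0 → u d = 0)
    (b : SLIndex n m) : br K n m (Pi.single b 1) u =
      -(∑ k, u (torus k) * weight k b) • Pi.single b 1 := by
  have : u = ∑ k, u (torus k) • Pi.single (torus k) 1 := by
    ext d
    rcases d with i | _ | _ | _ | i <;>
      simp [torus, Fin.sum_univ_three, Pi.single_apply, hu, height_X, height_Y]
  conv_lhs => rw [this]
  simp only [map_sum, map_smul, br_single, table_skew K b, table_torus, neg_smul, Finset.sum_smul,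
    smul_neg, Finset.sum_neg_distrib, mul_smul]

/-- The weights (1,0,0), (2,1,0), (1,0,1) of X₁, X₂, Y₁ are linearly independent, so the torus acts
faithfully on the span of the other basis vectors. -/
theorem eq_zero_of_br_eq_zero [CharZero K] (hn : 2 ≤ n) (hm : 1 ≤ m) (u : SLIndex n m → K)
    (hu : ∀ d, height d ≠ 0 → u d = 0)
    (h : ∀ b, height b ≠ 0 → br K n m (Pi.single b 1) u = 0) : u = 0 := by
  have key : ∀ b : SLIndex n m, height b ≠ 0 → ∑ k, u (torus k) * weight k b = 0 := by
    intro b hb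
    have := congrFun (h b hb) b
    rw [br_of_support_torus u hu] at this
    simpa using this
  have h1 := key (X ⟨0, by omega⟩) (by simp [height_X])
  have h2 := key (X ⟨1, by omega⟩) (by simp [height_X])
  have h3 := key (Y ⟨0, by omega⟩) (by simp [height_Y])
  simp [Fin.sum_univ_three, weight, torus] at h1 h2 h3
  simp [h1] at h2 h3
  ext d
  rcases d with i | _ | _ | _ | i <;> simp [hu, height_X, height_Y, h1, h2, h3]

/-- Additive functions on the weights are given by elements of the torus. -/
theorem exists_torus_of_additive (hn : 2 ≤ n) (hm : 1 ≤ m) (α : SLIndex n m → K)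
    (hα : ∀ a b d, height a = 1 → height b ≠ 0 → height b ≠ 1 → height a + height b = height d →
      α d = α a + α b) :
    ∃ u : SLIndex n m → K, (∀ d, height d ≠ 0 → u d = 0) ∧
      ∀ b, height b ≠ 0 → br K n m (Pi.single b 1) u = α b • Pi.single b 1 := by
  set x1 : SLIndex n m := X ⟨0, by omega⟩
  set x2 : SLIndex n m := X ⟨1, by omega⟩
  set y1 : SLIndex n m := Y ⟨0, by omega⟩
  -- The solution of the triangular system -∑ u_k w_k(b) = α(b) for b = X₁, X₂, Y₁, whose weights
  -- w(b) are (1,0,0), (2,1,0), (1,0,1). Both sides are additive along the strings, so equality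
  -- there propagates.
  set u : SLIndex n m → K := fun
    | T1 => -α x1
    | T2 => 2 * α x1 - α x2
    | T3 => α x1 - α y1
    | _ => 0
  have hu : ∀ d, height d ≠ 0 → u d = 0 := by
    rintro (i | _ | _ | _ | i) h <;> simp [u, height_T1, height_T2, height_T3] at h ⊢
  have hx : height x1 = 1 := by simp [x1, height_X]
  refine ⟨u, hu, fun b hb => ?_⟩
  rw [br_of_support_torus u hu]
  congr 1
  rw [← sub_eq_zero]
  refine eq_zero_of_strings hn hm (fun b => -(∑ k, u (torus k) * weight k b) - α b) ?_ ?_ ?_ ?_ b hb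
  · simp [Fin.sum_univ_three, u, torus, weight, x1]
  · simp [Fin.sum_univ_three, u, torus, weight, x2]; ring
  · simp [Fin.sum_univ_three, u, torus, weight, y1]
  · intro b d h0 h1 h
    rw [← hx] at h
    have ht : table K x1 b d ≠ 0 := by simp [table_of_height h hx h0 h1]
    simp only [hα x1 b d hx h0 h1 h, ← weight_add ht]
    simp [Fin.sum_univ_three, u, torus, weight, x1]
    ring

/-! ### Parity projections and coboundaries of linear maps. -/

/-- The projection to the part of parity `p`. -/
def partProj (p : ZMod 2) : (SLIndex n m → K) →ₗ[K] SLIndex n m → K :=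
  LinearMap.pi fun a => if parity a = p then LinearMap.proj a else 0

theorem partProj_apply (p : ZMod 2) (x : SLIndex n m → K) (a : SLIndex n m) :
    partProj p x a = if parity a = p then x a else 0 := by
  rw [partProj, LinearMap.pi_apply]
  split_ifs <;> rfl

theorem partProj_of_mem {p : ZMod 2} {x : SLIndex n m → K} (hx : ∀ a, parity a ≠ p → x a = 0) :
    partProj p x = x := by
  ext a
  rw [partProj_apply]
  split_ifs with h
  · rfl
  · exact (hx a h).symm

theorem partProj_of_mem_ne {p q : ZMod 2} (hpq : p ≠ q) {x : SLIndex n m → K}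
    (hx : ∀ a, parity a ≠ q → x a = 0) : partProj p x = 0 := by
  ext a
  rw [partProj_apply]
  split_ifs with h
  · exact hx a (h ▸ hpq)
  · rfl

theorem single_mem_part (a b : SLIndex n m) (h : parity b ≠ parity a) :
    (Pi.single a 1 : SLIndex n m → K) b = 0 := by
  rw [Pi.single_apply, if_neg]
  rintro rfl
  exact h rfl

theorem partProj_single {p : ZMod 2} {a : SLIndex n m} (h : parity a = p) :
    partProj p (Pi.single a 1) = (Pi.single a 1 : SLIndex n m → K) :=
  partProj_of_mem (h ▸ single_mem_part a)

theorem partProj_single_ne {p : ZMod 2} {a : SLIndex n m} (h : p ≠ parity a) :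
    partProj p (Pi.single a 1) = (0 : SLIndex n m → K) :=
  partProj_of_mem_ne h (single_mem_part a)

/-- The sign of the exchange of two basis vectors in a symmetric or alternating cochain, negated. -/
def sgn (K : Type*) [Field K] (a b : SLIndex n m) : K :=
  if parity a = 1 ∧ parity b = 1 then -1 else 1

/-- The coboundary of a linear map. -/
noncomputable def cob (ε : K) (e : (SLIndex n m → K) →ₗ[K] SLIndex n m → K) (x y : SLIndex n m → K) :
    SLIndex n m → K :=
  e (br K n m x y) - br K n m x (e y) + ε • br K n m y (e x)

/-! ### Removing the components of non-zero weight. -/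

theorem apply_br_rescale (e f : (SLIndex n m → K) →ₗ[K] SLIndex n m → K)
    (h : ∀ a d, height a ≠ height d →
      ((height a : K) - height d) * e (Pi.single a 1) d = f (Pi.single a 1) d)
    {a b d : SLIndex n m} (hd : height a + height b ≠ height d) :
    ((height a : K) + height b - height d) * e (br K n m (Pi.single a 1) (Pi.single b 1)) d =
      f (br K n m (Pi.single a 1) (Pi.single b 1)) d := by
  rw [br_single, apply_eq_sum, apply_eq_sum f, Finset.mul_sum]
  refine Finset.sum_congr rfl fun c _ => ?_
  by_cases hc : table K a b c = 0
  · simp [hc]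
  · have hh := height_add hc
    rw [← h c d (hh ▸ hd), ← hh]
    push_cast
    ring

theorem br_apply_rescale (e f : (SLIndex n m → K) →ₗ[K] SLIndex n m → K)
    (h : ∀ a d, height a ≠ height d →
      ((height a : K) - height d) * e (Pi.single a 1) d = f (Pi.single a 1) d)
    {a b d : SLIndex n m} (hd : height a + height b ≠ height d) :
    ((height a : K) + height b - height d) * br K n m (Pi.single a 1) (e (Pi.single b 1)) d =
      br K n m (Pi.single a 1) (f (Pi.single b 1)) d := by
  rw [br_single_apply, br_single_apply, Finset.mul_sum]
  refine Finset.sum_congr rfl fun c _ => ?_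
  by_cases hc : table K a c d = 0
  · simp [hc]
  · have hh := height_add hc
    rw [← h b c (by omega), ← hh]
    push_cast
    ring

/-- The bracket preserves heights, so the coefficient of `cob ε e` at (a, b; d) involves only
entries of `e` that shift the height by the same amount. Rescaling entries by their height shift
thus commutes with the coboundary. -/
theorem cob_rescale (ε : K) (e f : (SLIndex n m → K) →ₗ[K] SLIndex n m → K)
    (h : ∀ a d, height a ≠ height d →
      ((height a : K) - height d) * e (Pi.single a 1) d = f (Pi.single a 1) d)
    {a b d : SLIndex n m} (hd : height a + height b ≠ height d) :
    ((height a : K) + height b - height d) * cob ε e (Pi.single a 1) (Pi.single b 1) d =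
      cob ε f (Pi.single a 1) (Pi.single b 1) d := by
  simp only [cob, Pi.add_apply, Pi.sub_apply, Pi.smul_apply, smul_eq_mul,
    ← apply_br_rescale e f h hd, ← br_apply_rescale e f h hd,
    ← br_apply_rescale e f h (a := b) (b := a) (d := d) (by omega)]
  ring

theorem exists_rescale [CharZero K] (f : (SLIndex n m → K) →ₗ[K] SLIndex n m → K) :
    ∃ e : (SLIndex n m → K) →ₗ[K] SLIndex n m → K, ∀ a d, height a ≠ height d →
      ((height a : K) - height d) * e (Pi.single a 1) d = f (Pi.single a 1) d := by
  -- At equal heights the quotient is 0 by convention; those entries are unconstrained.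
  refine ⟨(Pi.basisFun K (SLIndex n m)).constr K fun a d =>
    f (Pi.single a 1) d / ((height a : K) - height d), fun a d h => ?_⟩
  rw [← Pi.basisFun_apply, Module.Basis.constr_basis]
  have : (height a : K) - height d ≠ 0 := sub_ne_zero.2 (by exact_mod_cast h)
  rw [Pi.basisFun_apply]
  field_simp

/-- Up to coboundaries, a 2-cocycle has weight zero. -/
theorem exists_cob_height [CharZero K]
    (B : (SLIndex n m → K) →ₗ[K] (SLIndex n m → K) →ₗ[K] SLIndex n m → K)
    (hB : ∀ a b, B (br K n m (generic K n m) (Pi.single a 1)) (Pi.single b 1)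
      + B (Pi.single a 1) (br K n m (generic K n m) (Pi.single b 1))
      - br K n m (generic K n m) (B (Pi.single a 1) (Pi.single b 1))
      = cob (sgn K a b) (B (generic K n m)) (Pi.single a 1) (Pi.single b 1)) :
    ∃ e : (SLIndex n m → K) →ₗ[K] SLIndex n m → K, ∀ a b d, height a + height b ≠ height d →
      B (Pi.single a 1) (Pi.single b 1) d = cob (sgn K a b) e (Pi.single a 1) (Pi.single b 1) d := by
  obtain ⟨e, he⟩ := exists_rescale (B (generic K n m))
  refine ⟨e, fun a b d h => ?_⟩
  have h0 : (height a : K) + height b - height d ≠ 0 := sub_ne_zero.2 (by exact_mod_cast h)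
  refine mul_left_cancel₀ h0 ?_
  rw [cob_rescale _ e _ he h, ← hB]
  simp only [br_generic, map_smul, LinearMap.smul_apply, Pi.add_apply, Pi.sub_apply, Pi.smul_apply,
    smul_eq_mul, br_generic_apply]
  ring

theorem cob_skew (e : (SLIndex n m → K) →ₗ[K] SLIndex n m → K) (x y : SLIndex n m → K) :
    cob 1 e x y = -cob 1 e y x := by
  simp only [cob, br_skew K y x, map_neg, one_smul]
  abel

/-- This is d ∘ d = 0 for an ordinary Lie algebra: `br` satisfies the Jacobi identity without signs
on the whole space. -/
theorem cob_cob (e : (SLIndex n m → K) →ₗ[K] SLIndex n m → K) (x y z : SLIndex n m → K) :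
    cob 1 e (br K n m x y) z + cob 1 e y (br K n m x z) - cob 1 e x (br K n m y z)
      - br K n m x (cob 1 e y z) + br K n m y (cob 1 e x z) - br K n m z (cob 1 e x y) = 0 := by
  have J : ∀ u v w : SLIndex n m → K, br K n m (br K n m u v) w =
      br K n m u (br K n m v w) - br K n m v (br K n m u w) := by
    intro u v w
    have := br_jacobi K u v w
    rw [br_skew K w u, br_skew K w (br K n m u v), map_neg] at this
    linear_combination (norm := module) -this
  simp only [cob, one_smul, map_add, map_sub, J]
  abel

/-! ### Two-cocycles of weight zero, and two-cocycles in general. -/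

theorem sgn_of_even_left {a b : SLIndex n m} (h : parity a = 0) : sgn K a b = 1 := by
  simp [sgn, h]

theorem sgn_of_even_right {a b : SLIndex n m} (h : parity b = 0) : sgn K a b = 1 := by
  simp [sgn, h]

/-- A non-zero height belongs to a single basis vector, so the corresponding eigenspace of the
generic torus element is a line. This turns weight-zero cochains into scalars. -/
theorem eq_smul_single {v : SLIndex n m → K} {b : SLIndex n m} (hb : height b ≠ 0)
    (h : ∀ d, height b ≠ height d → v d = 0) : v = v b • Pi.single b 1 := by
  ext d
  by_cases hd : d = b
  · simp [hd]
  · simp only [Pi.smul_apply, Pi.single_apply, hd, if_false, smul_zero]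
    exact h d fun h' => hd (height_injOn h'.symm hb)

theorem table_of_not_height {a b : SLIndex n m} (h : ∀ d : SLIndex n m, height a + height b ≠ height d) :
    table K a b = 0 := by
  ext d
  by_contra hd
  exact h d (height_add hd)

/-- A 2-cocycle of weight zero is a coboundary. -/
theorem exists_cob_of_height_zero [CharZero K] (hn : 2 ≤ n) (hm : 1 ≤ m)
    (B : (SLIndex n m → K) →ₗ[K] (SLIndex n m → K) →ₗ[K] SLIndex n m → K)
    (hw : ∀ a b d, height a + height b ≠ height d → B (Pi.single a 1) (Pi.single b 1) d = 0)
    (hs : ∀ a b, parity a = 0 → B (Pi.single a 1) (Pi.single b 1) =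
      -B (Pi.single b 1) (Pi.single a 1))
    (hB : ∀ a b c : SLIndex n m, parity a = 0 → parity b = 0 →
      B (table K a b) (Pi.single c 1) + B (Pi.single b 1) (table K a c)
      - B (Pi.single a 1) (table K b c) - br K n m (Pi.single a 1) (B (Pi.single b 1) (Pi.single c 1))
      + br K n m (Pi.single b 1) (B (Pi.single a 1) (Pi.single c 1))
      - br K n m (Pi.single c 1) (B (Pi.single a 1) (Pi.single b 1)) = 0) :
    ∃ e : (SLIndex n m → K) →ₗ[K] SLIndex n m → K, ∀ a b,
      B (Pi.single a 1) (Pi.single b 1) = cob (sgn K a b) e (Pi.single a 1) (Pi.single b 1) := by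
  have hT : ∀ k, parity (torus k : SLIndex n m) = 0 :=
    fun k => parity_of_height_zero (height_torus k)
  set α : Fin 3 → SLIndex n m → K := fun k b => B (Pi.single (torus k) 1) (Pi.single b 1) b with hα
  have hαb : ∀ k b, height b ≠ 0 →
      B (Pi.single (torus k) 1) (Pi.single b 1) = α k b • Pi.single b 1 := fun k b hb =>
    eq_smul_single hb fun d hd => hw _ _ _ (by rwa [height_torus, zero_add])
  -- The value has height 0, so it lies in the torus. In the cocycle identity for (T_k, T_l, b) the
  -- terms with α cancel, which leaves [b, B(T_k, T_l)] = 0 for every root vector b.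
  have hTT : ∀ k l, B (Pi.single (torus k) 1) (Pi.single (torus l) 1) = 0 := by
    intro k l
    refine eq_zero_of_br_eq_zero hn hm _ (fun d hd => hw _ _ _ ?_) fun b hb => ?_
    · simpa [height_torus] using hd.symm
    · have := hB (torus k) (torus l) b (hT k) (hT l)
      simp only [table_torus, weight_torus, map_smul, hαb _ _ hb, br_single,
        Nat.cast_zero, zero_smul, map_zero, LinearMap.zero_apply] at this
      linear_combination (norm := module) -this
  -- In the cocycle identity for (T_k, a, b) the terms with B(a, b) cancel, because the weights of a
  -- and b add up to that of d.
  have hadd : ∀ k a b d, height a = 1 → height b ≠ 0 → height b ≠ 1 →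
      height a + height b = height d → α k d = α k a + α k b := by
    intro k a b d ha hb hb1 h
    have ht : table K a b = Pi.single d 1 := table_of_height h ha hb hb1
    have := congrFun (hB (torus k) a b (hT k) (parity_of_height_one ha)) d
    have hwt := weight_add (K := K) (a := a) (b := b) (d := d) (by simp [ht]) k
    obtain ⟨r, hr⟩ : ∃ r : K, B (Pi.single a 1) (Pi.single b 1) = r • Pi.single d 1 :=
      ⟨_, eq_smul_single (by omega) fun d' hd => hw _ _ _ (by rwa [h])⟩
    simp only [table_torus, map_smul, LinearMap.smul_apply, hαb _ _ hb,
      hαb k a (by omega), hαb k d (by omega), br_single, ht, table_skew K b a, hr, ← hwt] at this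
    simp at this
    linear_combination -this
  choose u hu hub using fun k => exists_torus_of_additive hn hm (α k) (hadd k)
  have hTu : ∀ k l, br K n m (Pi.single (torus k) 1) (u l) = 0 := by
    intro k l
    rw [br_of_support_torus _ (hu l)]
    simp [weight_torus]
  obtain ⟨f, hf1, hf⟩ := exists_of_increments fun b d =>
    B (Pi.single (X ⟨0, by omega⟩) 1) (Pi.single b 1) d
  -- The torus images account for B(T_k, b) = α_k(b) b through [b, u_k]. The diagonal part accounts
  -- for B(X₁, b), since its coboundary there is (f(d) - f(b) - f(X₁)) d with f(X₁) = 0; it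
  -- contributes nothing on pairs (T_k, b).
  set e : (SLIndex n m → K) →ₗ[K] SLIndex n m → K := (Pi.basisFun K (SLIndex n m)).constr K fun
    | T1 => u 0
    | T2 => u 1
    | T3 => u 2
    | b => f b • Pi.single b 1
  have heT : ∀ k, e (Pi.single (torus k) 1) = u k := by
    intro k
    rw [← Pi.basisFun_apply, Module.Basis.constr_basis]
    fin_cases k <;> rfl
  have heb : ∀ b, height b ≠ 0 → e (Pi.single b 1) = f b • Pi.single b 1 := by
    intro b hb
    rw [← Pi.basisFun_apply, Module.Basis.constr_basis]
    rcases b with i | _ | _ | _ | i <;>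
      simp only [height_T1, height_T2, height_T3, ne_eq, not_true_eq_false] at hb <;> simp
  refine ⟨e, ?_⟩
  have swap : ∀ a b, parity a = 0 → B (Pi.single a 1) (Pi.single b 1) =
      cob (sgn K a b) e (Pi.single a 1) (Pi.single b 1) → B (Pi.single b 1) (Pi.single a 1) =
      cob (sgn K b a) e (Pi.single b 1) (Pi.single a 1) := by
    intro a b ha h
    rw [sgn_of_even_left ha] at h
    rw [sgn_of_even_right ha, cob_skew, ← h, hs a b ha, neg_neg]
  have hTb : ∀ k b, B (Pi.single (torus k) 1) (Pi.single b 1) =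
      cob (sgn K (torus k) b) e (Pi.single (torus k) 1) (Pi.single b 1) := by
    intro k b
    by_cases hb : height b = 0
    · obtain ⟨l, rfl⟩ := eq_torus_of_height hb
      simp [hTT, cob, heT, hTu, br_single, table_torus, weight_torus]
    · rw [hαb k b hb, sgn_of_even_left (hT k)]
      simp only [cob, heT, heb b hb, br_single, table_torus, hub k b hb, map_smul, one_smul]
      module
  have hab : ∀ a b d : SLIndex n m, height a = 1 → height b ≠ 0 → height b ≠ 1 →
      height a + height b = height d → B (Pi.single a 1) (Pi.single b 1) =
      cob (sgn K a b) e (Pi.single a 1) (Pi.single b 1) := by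
    intro a b d ha hb hb1 h
    have hB' : B (Pi.single a 1) (Pi.single b 1) = B (Pi.single a 1) (Pi.single b 1) d • Pi.single d 1 :=
      eq_smul_single (by omega) fun d' hd => hw _ _ _ (by rwa [h])
    have hfd := hf b d hb hb1 (by omega)
    rw [← eq_X_zero_of_height hn ha] at hfd
    rw [hB']
    simp only [cob, br_single, table_of_height h ha hb hb1, heb b hb, heb a (by omega), hf1 a ha,
      heb d (by omega), map_smul, hfd]
    module
  intro a b
  by_cases ha : height a = 0
  · obtain ⟨k, rfl⟩ := eq_torus_of_height ha
    exact hTb k b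
  by_cases hb : height b = 0
  · obtain ⟨k, rfl⟩ := eq_torus_of_height hb
    exact swap _ _ (hT k) (hTb k a)
  by_cases h : ∃ d : SLIndex n m, height a + height b = height d
  · obtain ⟨d, hd⟩ := h
    rcases height_add_eq hd ha hb with ⟨h1, h2⟩ | ⟨h1, h2⟩
    · exact hab a b d h1 hb h2 hd
    · exact swap _ _ (parity_of_height_one h1) (hab b a d h1 ha h2 (by omega))
  · push Not at h
    rw [show B (Pi.single a 1) (Pi.single b 1) = 0 from funext fun d => hw a b d (h d)]
    simp [cob, br_single, heb a ha, heb b hb, table_of_not_height h,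
      table_of_not_height fun d : SLIndex n m => (add_comm (height b) (height a)).symm ▸ h d]

/-- A 2-cocycle is a coboundary. -/
theorem exists_cob [CharZero K] (hn : 2 ≤ n) (hm : 1 ≤ m)
    (B : (SLIndex n m → K) →ₗ[K] (SLIndex n m → K) →ₗ[K] SLIndex n m → K)
    (hs : ∀ a b, parity a = 0 → B (Pi.single a 1) (Pi.single b 1) =
      -B (Pi.single b 1) (Pi.single a 1))
    (hB : ∀ a b c : SLIndex n m, parity a = 0 → parity b = 0 →
      B (table K a b) (Pi.single c 1) + B (Pi.single b 1) (table K a c)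
      - B (Pi.single a 1) (table K b c) - br K n m (Pi.single a 1) (B (Pi.single b 1) (Pi.single c 1))
      + br K n m (Pi.single b 1) (B (Pi.single a 1) (Pi.single c 1))
      - br K n m (Pi.single c 1) (B (Pi.single a 1) (Pi.single b 1)) = 0)
    (hO : ∀ a b c : SLIndex n m, parity a = 0 → parity b = 1 → parity c = 1 →
      B (table K a b) (Pi.single c 1) + B (Pi.single b 1) (table K a c)
      - B (Pi.single a 1) (table K b c) - br K n m (Pi.single a 1) (B (Pi.single b 1) (Pi.single c 1))
      + br K n m (Pi.single b 1) (B (Pi.single a 1) (Pi.single c 1))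
      + br K n m (Pi.single c 1) (B (Pi.single a 1) (Pi.single b 1)) = 0) :
    ∃ e : (SLIndex n m → K) →ₗ[K] SLIndex n m → K, ∀ a b,
      B (Pi.single a 1) (Pi.single b 1) = cob (sgn K a b) e (Pi.single a 1) (Pi.single b 1) := by
  have hT : ∀ k, parity (torus k : SLIndex n m) = 0 :=
    fun k => parity_of_height_zero (height_torus k)
  have hP : ∀ a : SLIndex n m, parity a ≠ 0 → parity a = 1 := fun a => by
    generalize parity a = p; revert p; decide
  -- The Cartan homotopy formula: the Lie derivative of B along T_k is the coboundary of the
  -- contraction B(T_k, ·). For two odd arguments it comes from `hO`, whence the sign `sgn`.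
  have H : ∀ k a b, B (table K (torus k) a) (Pi.single b 1) + B (Pi.single a 1) (table K (torus k) b)
      - br K n m (Pi.single (torus k) 1) (B (Pi.single a 1) (Pi.single b 1)) =
      cob (sgn K a b) (B (Pi.single (torus k) 1)) (Pi.single a 1) (Pi.single b 1) := by
    intro k a b
    by_cases ha : parity a = 0
    · rw [sgn_of_even_left ha]
      simp only [cob, br_single]
      linear_combination (norm := module) hB (torus k) a b (hT k) ha
    by_cases hb : parity b = 0
    · rw [sgn_of_even_right hb]
      have := hB (torus k) b a (hT k) hb
      simp only [cob, br_single, table_torus, map_smul, LinearMap.smul_apply, hs b a hb,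
        table_skew K b a, map_neg] at this ⊢
      linear_combination (norm := module) -this
    · have := hO (torus k) a b (hT k) (hP a ha) (hP b hb)
      simp only [cob, br_single, sgn, hP a ha, hP b hb, and_self, if_true, neg_smul, one_smul]
      linear_combination (norm := module) this
  obtain ⟨e, he⟩ := exists_cob_height B fun a b => by
    have h1 := H 0 a b
    have h2 := H 1 a b
    have h3 := H 2 a b
    simp only [torus, Matrix.cons_val, cob, ← br_single] at h1 h2 h3
    simp only [generic, cob, map_add, LinearMap.add_apply, map_nsmul, LinearMap.smul_apply]
    linear_combination (norm := module) h1 + (4 * (n + m + 2) : ℕ) • h2 + (16 * (n + m + 2) : ℕ) • h3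
  -- The sum of two odd heights exceeds 32 (n + m + 2), beyond every height. So on two odd arguments
  -- `he` already gives all of B.
  have hodd : ∀ a b d : SLIndex n m, parity a ≠ 0 → parity b ≠ 0 → height a + height b ≠ height d := by
    intro a b d ha hb
    rcases a with i | _ | _ | _ | i <;> rcases b with j | _ | _ | _ | j <;> simp [parity] at ha hb
    rcases d with l | _ | _ | _ | l <;>
      simp only [height_X, height_Y, height_T1, height_T2, height_T3] <;> (try split_ifs) <;> omega
  set C₀ : (SLIndex n m → K) →ₗ[K] (SLIndex n m → K) →ₗ[K] SLIndex n m → K :=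
    B - ((br K n m).compr₂ e - (br K n m).compl₂ e + ((br K n m).compl₂ e).flip) with hC₀
  have hC₀B : ∀ x y, C₀ x y = B x y - cob 1 e x y := by
    intro x y
    simp [hC₀, cob]
  -- `C₀` subtracts the coboundary with sign 1, which is wrong on two odd arguments. There the true
  -- difference is 0, so the projections discard this block.
  set C : (SLIndex n m → K) →ₗ[K] (SLIndex n m → K) →ₗ[K] SLIndex n m → K :=
    C₀ ∘ₗ partProj 0 + (C₀ ∘ₗ partProj 1).compl₂ (partProj 0) with hC
  have hCE : ∀ x y, (∀ a, parity a ≠ 0 → x a = 0) → C x y = B x y - cob 1 e x y := by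
    intro x y hx
    have h0 : partProj 0 x = x := partProj_of_mem hx
    have h1 : partProj 1 x = 0 := partProj_of_mem_ne (by decide) hx
    simp [hC, h0, h1, hC₀B]
  have hsE : ∀ a : SLIndex n m, parity a = 0 → ∀ b, parity b ≠ 0 → (Pi.single a 1 : _ → K) b = 0 :=
    fun a ha b hb => single_mem_part a b (ha ▸ hb)
  have hCab : ∀ a b, C (Pi.single a 1) (Pi.single b 1) = B (Pi.single a 1) (Pi.single b 1) -
      cob (sgn K a b) e (Pi.single a 1) (Pi.single b 1) := by
    intro a b
    by_cases ha : parity a = 0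
    · rw [hCE _ _ (hsE a ha), sgn_of_even_left ha]
    have h0 : (partProj 0 (Pi.single a 1) : _ → K) = 0 := partProj_single_ne (Ne.symm ha)
    have h1 : (partProj 1 (Pi.single a 1) : _ → K) = Pi.single a 1 := partProj_single (hP a ha)
    by_cases hb : parity b = 0
    · have h2 : (partProj 0 (Pi.single b 1) : _ → K) = Pi.single b 1 := partProj_single hb
      simp [hC, h0, h1, h2, hC₀B, sgn_of_even_right hb]
    · have h2 : (partProj 0 (Pi.single b 1) : _ → K) = 0 := partProj_single_ne (Ne.symm hb)
      rw [show B (Pi.single a 1) (Pi.single b 1) = cob (sgn K a b) e (Pi.single a 1) (Pi.single b 1)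
        from funext fun d => he a b d (hodd a b d ha hb)]
      simp [hC, h0, h2]
  obtain ⟨e', he'⟩ := exists_cob_of_height_zero hn hm C
    (fun a b d h => by rw [hCab, Pi.sub_apply, he a b d h, sub_self])
    (fun a b ha => by
      rw [hCab, hCab, sgn_of_even_left ha, sgn_of_even_right ha, cob_skew, hs a b ha]
      abel)
    (fun a b c ha hb => by
      have ht : ∀ d, parity d ≠ 0 → table K a b d = 0 := fun d hd =>
        table_parity K a b d (by rwa [ha, hb, add_zero])
      rw [hCE _ _ ht, hCE _ _ (hsE a ha), hCE _ _ (hsE b hb), hCE _ _ (hsE b hb),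
        hCE _ _ (hsE a ha), hCE _ _ (hsE a ha)]
      have h := cob_cob e (Pi.single a 1) (Pi.single b 1) (Pi.single c 1)
      simp only [br_single] at h
      simp only [map_sub]
      linear_combination (norm := module) hB a b c ha hb - h)
  refine ⟨e + e', fun a b => ?_⟩
  have h := he' a b
  rw [hCab, sub_eq_iff_eq_add] at h
  rw [h]
  simp only [cob, LinearMap.add_apply, map_add]
  module

/-! ### One-cocycles and the centre. -/

/-- A 1-cocycle is a coboundary. -/
theorem exists_inner [CharZero K] (hn : 2 ≤ n) (hm : 1 ≤ m)
    (c : (SLIndex n m → K) →ₗ[K] SLIndex n m → K)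
    (hc : ∀ a b : SLIndex n m, parity a = 0 → cob 1 c (Pi.single a 1) (Pi.single b 1) = 0) :
    ∃ v, ∀ x, c x = br K n m x v := by
  have hT : ∀ k, parity (torus k : SLIndex n m) = 0 :=
    fun k => parity_of_height_zero (height_torus k)
  -- Dividing c(t) by the eigenvalues of the generic element t gives the inner derivation that
  -- carries the non-zero weights of c.
  obtain ⟨v, hv⟩ : ∃ v : SLIndex n m → K, ∀ d, height d ≠ 0 →
      (height d : K) * v d = c (generic K n m) d :=
    ⟨fun d => c (generic K n m) d / height d, fun d hd => by
      have : (height d : K) ≠ 0 := by exact_mod_cast hd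
      field_simp⟩
  set c' : (SLIndex n m → K) →ₗ[K] SLIndex n m → K := c - (br K n m).flip v with hc'
  have hcc : ∀ x, c' x = c x - br K n m x v := fun x => by simp [hc']
  have hc'0 : ∀ a b : SLIndex n m, parity a = 0 → cob 1 c' (Pi.single a 1) (Pi.single b 1) = 0 := by
    intro a b ha
    have := hc a b ha
    have J := br_jacobi K (Pi.single a 1) (Pi.single b 1) v
    rw [br_skew K v, br_skew K v, map_neg] at J
    simp only [cob, hcc, map_sub, one_smul] at this ⊢
    linear_combination (norm := module) this + J
  have hw : ∀ b d, height b ≠ height d → c' (Pi.single b 1) d = 0 := by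
    intro b d h
    have h0 : (height d : K) - height b ≠ 0 := sub_ne_zero.2 (by exact_mod_cast h.symm)
    have hg : cob 1 c (generic K n m) (Pi.single b 1) = 0 := by
      have h1 := hc (torus 0) b (hT 0)
      have h2 := hc (torus 1) b (hT 1)
      have h3 := hc (torus 2) b (hT 2)
      simp only [torus, Matrix.cons_val, cob] at h1 h2 h3
      simp only [generic, cob, map_add, LinearMap.add_apply, map_nsmul, LinearMap.smul_apply]
      linear_combination (norm := module) h1 + (4 * (n + m + 2) : ℕ) • h2 + (16 * (n + m + 2) : ℕ) • h3
    have hd := congrFun hg d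
    simp only [cob, br_generic, map_smul, one_smul, Pi.add_apply, Pi.sub_apply, Pi.smul_apply,
      br_generic_apply, smul_eq_mul, Pi.zero_apply] at hd
    have key : ((height d : K) - height b) * br K n m (Pi.single b 1) v d =
        br K n m (Pi.single b 1) (c (generic K n m)) d := by
      rw [br_single_apply, br_single_apply, Finset.mul_sum]
      refine Finset.sum_congr rfl fun a _ => ?_
      by_cases ha : table K b a d = 0
      · simp [ha]
      · have hh := height_add ha
        rw [← hv a (by omega), ← hh]
        push_cast
        ring
    refine mul_left_cancel₀ h0 ?_
    rw [hcc, Pi.sub_apply, mul_sub, key]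
    linear_combination -hd
  set α : SLIndex n m → K := fun b => c' (Pi.single b 1) b
  have hαb : ∀ b, height b ≠ 0 → c' (Pi.single b 1) = α b • Pi.single b 1 := fun b hb =>
    eq_smul_single hb fun d hd => hw _ _ hd
  -- The derivation rule on [T_k, b], with b an eigenvector of c', forces [b, c'(T_k)] = 0, and the
  -- torus acts faithfully.
  have hT0 : ∀ k, c' (Pi.single (torus k) 1) = 0 := by
    intro k
    refine eq_zero_of_br_eq_zero hn hm _ (fun d hd => hw _ _ ?_) fun b hb => ?_
    · simpa [height_torus] using hd.symm
    · have := hc'0 (torus k) b (hT k)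
      simp only [cob, br_single, table_torus, map_smul, hαb b hb, one_smul] at this
      linear_combination (norm := module) this
  obtain ⟨u, hu, hub⟩ := exists_torus_of_additive hn hm α fun a b d ha hb hb1 h => by
    have ht : table K a b = Pi.single d 1 := table_of_height h ha hb hb1
    have := congrFun (hc'0 a b (parity_of_height_one ha)) d
    simp only [cob, br_single, hαb b hb, hαb a (by omega), hαb d (by omega), map_smul, ht,
      table_skew K b a] at this
    simp at this
    linear_combination this
  have hcu : c' = (br K n m).flip u := by
    refine (Pi.basisFun K (SLIndex n m)).ext fun b => ?_
    rw [Pi.basisFun_apply, LinearMap.flip_apply]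
    by_cases hb : height b = 0
    · obtain ⟨k, rfl⟩ := eq_torus_of_height hb
      rw [hT0, br_of_support_torus u hu]
      simp [weight_torus]
    · rw [hαb b hb, hub b hb]
  refine ⟨v + u, fun x => ?_⟩
  have := hcc x
  rw [hcu, LinearMap.flip_apply] at this
  rw [map_add, this]
  abel

/-- The centre is trivial. -/
theorem eq_zero_of_br_single_eq_zero [CharZero K] (hn : 2 ≤ n) (hm : 1 ≤ m) (v : SLIndex n m → K)
    (h : ∀ a, br K n m (Pi.single a 1) v = 0) : v = 0 := by
  refine eq_zero_of_br_eq_zero hn hm v (fun d hd => ?_) fun b _ => h b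
  have := br_generic_apply v d
  simp only [generic, map_add, map_nsmul, LinearMap.add_apply, LinearMap.smul_apply, h, smul_zero,
    add_zero, Pi.zero_apply] at this
  have h0 : (height d : K) ≠ 0 := by exact_mod_cast hd
  simpa [h0] using this.symm

end SLIndex

/-! ### Cochains of low degree as linear and bilinear maps. -/

theorem MultilinearMap.exists_bilinear {R M N : Type*} [CommRing R] [AddCommGroup M] [Module R M]
    [AddCommGroup N] [Module R N] (f : MultilinearMap R (fun _ : Fin 2 => M) N) :
    ∃ β : M →ₗ[R] M →ₗ[R] N, ∀ v, f v = β (v 0) (v 1) := by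
  have h0 : ∀ x y : M, Function.update ![0, y] 0 x = ![x, y] := fun x y => by
    ext i; fin_cases i <;> simp
  have h1 : ∀ x y : M, Function.update ![x, 0] 1 y = ![x, y] := fun x y => by
    ext i; fin_cases i <;> simp
  refine ⟨LinearMap.mk₂ R (fun x y => f ![x, y]) ?_ ?_ ?_ ?_, fun v => ?_⟩
  · intro x x' y
    simpa only [h0] using f.map_update_add ![0, y] 0 x x'
  · intro r x y
    simpa only [h0] using f.map_update_smul ![0, y] 0 r x
  · intro x y y'
    simpa only [h1] using f.map_update_add ![x, 0] 1 y y'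
  · intro r x y
    simpa only [h1] using f.map_update_smul ![x, 0] 1 r y
  · rw [LinearMap.mk₂_apply]
    congr 1
    ext i; fin_cases i <;> rfl

theorem MultilinearMap.exists_linear {R M N : Type*} [CommRing R] [AddCommGroup M] [Module R M]
    [AddCommGroup N] [Module R N] (f : MultilinearMap R (fun _ : Fin 1 => M) N) :
    ∃ β : M →ₗ[R] N, ∀ v, f v = β (v 0) := by
  refine ⟨(MultilinearMap.ofSubsingleton R M N (0 : Fin 1)).symm f, fun v => ?_⟩
  rw [MultilinearMap.ofSubsingleton_symm_apply_apply]
  congr 1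
  ext i; fin_cases i; rfl

namespace LieSuperalgebra

variable {K L : Type*} [Field K] [AddCommGroup L] [Module K L] (𝔤 : LieSuperalgebra K L)

theorem IsAltSymm.exists_two_zero {f : (Fin 2 → 𝔤.part 0) → (Fin 0 → 𝔤.part 1) → L}
    (hf : 𝔤.IsAltSymm f) : ∃ β : 𝔤.part 0 →ₗ[K] 𝔤.part 0 →ₗ[K] L,
      (∀ g h, f g h = β (g 0) (g 1)) ∧ ∀ x y, β x y = -β y x := by
  obtain ⟨φ, -, hφ⟩ := hf
  obtain ⟨β, hβ⟩ := φ.toMultilinearMap.exists_bilinear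
  have hβ' : ∀ x y, φ ![x, y] = β x y := fun x y => hβ ![x, y]
  refine ⟨LinearMap.mk₂ K (fun x y => β x y ![]) (by simp) (by simp) (by simp) (by simp),
    fun g h => ?_, fun x y => ?_⟩
  · rw [hφ, show φ g = β (g 0) (g 1) from hβ g, Subsingleton.elim h ![]]
    rfl
  · have : β x y = -β y x := by
      rw [← hβ', ← hβ', ← φ.map_swap ![y, x] (i := 0) (j := 1) (by decide)]
      congr 1
      ext i; fin_cases i <;> simp
    simp [this]

theorem IsAltSymm.exists_one_one {f : (Fin 1 → 𝔤.part 0) → (Fin 1 → 𝔤.part 1) → L}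
    (hf : 𝔤.IsAltSymm f) : ∃ β : 𝔤.part 0 →ₗ[K] 𝔤.part 1 →ₗ[K] L,
      ∀ g h, f g h = β (g 0) (h 0) := by
  obtain ⟨φ, -, hφ⟩ := hf
  obtain ⟨β, hβ⟩ := φ.toMultilinearMap.exists_linear
  refine ⟨LinearMap.mk₂ K (fun x y => β x ![y]) ?_ ?_ ?_ ?_, fun g h => ?_⟩
  · simp
  · simp
  · intro x y y'
    obtain ⟨γ, hγ⟩ := (β x).exists_linear
    simp [hγ]
  · intro r x y
    obtain ⟨γ, hγ⟩ := (β x).exists_linear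
    simp [hγ]
  · rw [hφ, show φ g = β (g 0) from hβ g, LinearMap.mk₂_apply]
    congr 1
    ext i; fin_cases i; rfl

theorem IsAltSymm.exists_zero_two {f : (Fin 0 → 𝔤.part 0) → (Fin 2 → 𝔤.part 1) → L}
    (hf : 𝔤.IsAltSymm f) : ∃ β : 𝔤.part 1 →ₗ[K] 𝔤.part 1 →ₗ[K] L,
      (∀ g h, f g h = β (h 0) (h 1)) ∧ ∀ x y, β x y = β y x := by
  obtain ⟨φ, hs, hφ⟩ := hf
  obtain ⟨β, hβ⟩ := (φ ![]).exists_bilinear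
  refine ⟨β, fun g h => ?_, fun x y => ?_⟩
  · rw [hφ, ← hβ, Subsingleton.elim g ![]]
  · have := hs ![] ![x, y] (Equiv.swap 0 1)
    simp only [hβ] at this
    simpa using this.symm

theorem IsAltSymm.exists_one_zero {f : (Fin 1 → 𝔤.part 0) → (Fin 0 → 𝔤.part 1) → L}
    (hf : 𝔤.IsAltSymm f) : ∃ β : 𝔤.part 0 →ₗ[K] L, ∀ g h, f g h = β (g 0) := by
  obtain ⟨φ, -, hφ⟩ := hf
  obtain ⟨β, hβ⟩ := φ.toMultilinearMap.exists_linear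
  refine ⟨{ toFun := fun x => β x ![], map_add' := by simp, map_smul' := by simp }, fun g h => ?_⟩
  rw [hφ, show φ g = β (g 0) from hβ g, Subsingleton.elim h ![]]
  rfl

theorem IsAltSymm.exists_zero_one {f : (Fin 0 → 𝔤.part 0) → (Fin 1 → 𝔤.part 1) → L}
    (hf : 𝔤.IsAltSymm f) : ∃ β : 𝔤.part 1 →ₗ[K] L, ∀ g h, f g h = β (h 0) := by
  obtain ⟨φ, -, hφ⟩ := hf
  obtain ⟨β, hβ⟩ := (φ ![]).exists_linear
  exact ⟨β, fun g h => by rw [hφ, ← hβ, Subsingleton.elim g ![]]⟩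

/-- The 0-cochain with a given value. -/
def cochainZero (v : L) : 𝔤.RawCochain
  | 0, 0, _, _ => v
  | _, _, _, _ => 0

theorem cochainZero_mem (v : L) : 𝔤.cochainZero v ∈ 𝔤.cochains 0 := by
  refine ⟨fun q₀ q₁ h => ?_, fun q₀ q₁ h => ?_⟩
  · obtain ⟨rfl, rfl⟩ : q₀ = 0 ∧ q₁ = 0 := by omega
    exact ⟨AlternatingMap.constOfIsEmpty K _ _ (MultilinearMap.constOfIsEmpty K _ v),
      fun _ _ _ => rfl, fun _ _ => rfl⟩
  · rcases q₀ with _ | q₀ <;> rcases q₁ with _ | q₁ <;> first | rfl | omega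

/-- The 1-cochain given by a linear map. -/
def cochainOne (e : L →ₗ[K] L) : 𝔤.RawCochain
  | 1, 0, g, _ => e (g 0)
  | 0, 1, _, h => e (h 0)
  | _, _, _, _ => 0

theorem cochainOne_mem (e : L →ₗ[K] L) : 𝔤.cochainOne e ∈ 𝔤.cochains 1 := by
  refine ⟨fun q₀ q₁ h => ?_, fun q₀ q₁ h => ?_⟩
  · obtain ⟨rfl, rfl⟩ | ⟨rfl, rfl⟩ : (q₀ = 1 ∧ q₁ = 0) ∨ (q₀ = 0 ∧ q₁ = 1) := by omega
    · exact ⟨AlternatingMap.ofSubsingleton K _ _ 0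
        ((MultilinearMap.constLinearEquivOfIsEmpty K K _ L).toLinearMap ∘ₗ
          e ∘ₗ (𝔤.part 0).subtype), fun _ _ _ => rfl, fun _ _ => rfl⟩
    · exact ⟨AlternatingMap.constOfIsEmpty K _ _
        (MultilinearMap.ofSubsingleton K _ _ 0 (e ∘ₗ (𝔤.part 1).subtype)),
        fun g h σ => by rw [Subsingleton.elim σ 1]; rfl, fun _ _ => rfl⟩
  · rcases q₀ with _ | _ | q₀ <;> rcases q₁ with _ | _ | q₁ <;> first | rfl | omega

theorem subsingleton_cohomology {q : ℕ} (h : 𝔤.cocycles q ≤ 𝔤.coboundaries q) :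
    Subsingleton (𝔤.Cohomology q) :=
  Submodule.Quotient.subsingleton_iff.2 (Submodule.comap_subtype_eq_top.2 h)

end LieSuperalgebra

/-! ### Vanishing of the cohomology in degrees 0, 1, 2. -/

namespace SLIndex

variable {n m : ℕ} {K : Type*} [Field K]

/-- The projection to a homogeneous part of `SL^{n,m}`. -/
noncomputable def toPart (p : ZMod 2) : (SLIndex n m → K) →ₗ[K] (SL K n m).part p :=
  (partProj p).codRestrict _ fun x a ha => by rw [partProj_apply, if_neg ha]

theorem toPart_coe {p : ZMod 2} (x : (SL K n m).part p) : toPart p (x : SLIndex n m → K) = x :=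
  Subtype.ext (partProj_of_mem x.2)

theorem toPart_coe_ne {p q : ZMod 2} (h : p ≠ q) (x : (SL K n m).part q) :
    toPart p (x : SLIndex n m → K) = 0 :=
  Subtype.ext (partProj_of_mem_ne h x.2)

/-- A basis vector as an element of its homogeneous part. -/
noncomputable def basisPart (K : Type*) [Field K] {p : ZMod 2} (a : SLIndex n m) (h : parity a = p) :
    (SL K n m).part p :=
  ⟨Pi.single a 1, fun b hb => single_mem_part a b (h ▸ hb)⟩

theorem exists_parity (a : SLIndex n m) : parity a = 0 ∨ parity a = 1 := by
  generalize parity a = p; revert p; decide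

/-- Composing with the surjection `toPart p` reduces the claim to the standard basis of the whole
space, where basis vectors of the other parity map to 0. -/
theorem ext_part {p : ZMod 2} {M : Type*} [AddCommGroup M] [Module K M]
    {f f' : (SL K n m).part p →ₗ[K] M}
    (h : ∀ a (ha : parity a = p), f (basisPart K a ha) = f' (basisPart K a ha)) : f = f' := by
  have : f ∘ₗ toPart p = f' ∘ₗ toPart p := by
    refine (Pi.basisFun K (SLIndex n m)).ext fun a => ?_
    rw [Pi.basisFun_apply]
    by_cases ha : parity a = p
    · have : toPart p (Pi.single a 1) = basisPart K a ha := toPart_coe (basisPart K a ha)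
      simp [this, h]
    · have : (toPart p (Pi.single a 1) : (SL K n m).part p) = 0 := toPart_coe_ne (Ne.symm ha)
        (basisPart K a rfl)
      simp [this]
  ext x : 1
  rw [← toPart_coe x]
  exact LinearMap.congr_fun this x

theorem eq_on_parts {p q : ZMod 2}
    {B D : (SLIndex n m → K) →ₗ[K] (SLIndex n m → K) →ₗ[K] SLIndex n m → K}
    (h : ∀ a b, parity a = p → parity b = q →
      B (Pi.single a 1) (Pi.single b 1) = D (Pi.single a 1) (Pi.single b 1))
    (x : (SL K n m).part p) (y : (SL K n m).part q) : B x y = D x y := by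
  have : B.domRestrict₁₂ ((SL K n m).part p) ((SL K n m).part q) = D.domRestrict₁₂ _ _ :=
    ext_part fun a ha => ext_part fun b hb => h a b ha hb
  exact LinearMap.congr_fun₂ this x y

theorem eq_cob_on_parts {p q : ZMod 2}
    {B : (SLIndex n m → K) →ₗ[K] (SLIndex n m → K) →ₗ[K] SLIndex n m → K}
    {e : (SLIndex n m → K) →ₗ[K] SLIndex n m → K} {ε : K}
    (h : ∀ a b, parity a = p → parity b = q →
      B (Pi.single a 1) (Pi.single b 1) = cob ε e (Pi.single a 1) (Pi.single b 1))
    (x : (SL K n m).part p) (y : (SL K n m).part q) : B x y = cob ε e x y :=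
  -- The bundled form of the bilinear map `cob ε e`, equal to it by definition.
  eq_on_parts (D := (br K n m).compr₂ e - (br K n m).compl₂ e + ε • ((br K n m).compl₂ e).flip)
    h x y

theorem cohomology_zero [CharZero K] (hn : 2 ≤ n) (hm : 1 ≤ m) :
    (SL K n m).cocycles 0 ≤ (SL K n m).coboundaries 0 := by
  rintro c ⟨hc, hd : (SL K n m).d c = 0⟩
  replace hc : c ∈ (SL K n m).cochains 0 := hc
  have hv : c 0 0 ![] ![] = 0 := by
    refine eq_zero_of_br_single_eq_zero hn hm _ fun a => ?_
    rcases exists_parity a with ha | ha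
    · have := (SL K n m).d_one_zero c (basisPart K a ha)
      rw [hd] at this
      exact (neg_eq_zero.1 this.symm)
    · have := (SL K n m).d_zero_one c (basisPart K a ha)
      rw [hd] at this
      exact (neg_eq_zero.1 this.symm)
  refine (Submodule.mem_bot K).2 ?_
  funext q₀ q₁
  by_cases h : q₀ + q₁ = 0
  · obtain ⟨rfl, rfl⟩ : q₀ = 0 ∧ q₁ = 0 := by omega
    funext g h
    rw [Subsingleton.elim g ![], Subsingleton.elim h ![], hv]
    rfl
  · exact hc.2 q₀ q₁ h

theorem cohomology_one [CharZero K] (hn : 2 ≤ n) (hm : 1 ≤ m) :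
    (SL K n m).cocycles 1 ≤ (SL K n m).coboundaries 1 := by
  rintro c ⟨hc, hd : (SL K n m).d c = 0⟩
  replace hc : c ∈ (SL K n m).cochains 1 := hc
  obtain ⟨β₀, h₀⟩ := (hc.1 1 0 rfl).exists_one_zero
  obtain ⟨β₁, h₁⟩ := (hc.1 0 1 rfl).exists_zero_one
  set f : (SLIndex n m → K) →ₗ[K] SLIndex n m → K := β₀ ∘ₗ toPart 0 + β₁ ∘ₗ toPart 1 with hf
  have hf0 : ∀ x : (SL K n m).part 0, f x = β₀ x := fun x => by
    simp [hf, toPart_coe, toPart_coe_ne]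
  have hf1 : ∀ x : (SL K n m).part 1, f x = β₁ x := fun x => by
    simp [hf, toPart_coe, toPart_coe_ne]
  obtain ⟨v, hv⟩ := exists_inner hn hm f fun a b ha => by
    rcases exists_parity b with hb | hb
    · have := (SL K n m).d_two_zero c (basisPart K a ha) (basisPart K b hb)
      rw [hd, h₀, h₀, h₀] at this
      simp only [Matrix.cons_val_zero, ← hf0] at this
      rw [cob, one_smul]
      exact this.symm
    · have := (SL K n m).d_one_one c (basisPart K a ha) (basisPart K b hb)
      rw [hd, h₀, h₁, h₁] at this
      simp only [Matrix.cons_val_zero, ← hf0, ← hf1] at this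
      rw [cob, one_smul]
      exact this.symm
  -- The differential of the 0-cochain w is x ↦ -[x, w], hence the sign.
  refine ⟨_, (SL K n m).cochainZero_mem (-v), ?_⟩
  funext q₀ q₁
  by_cases h : q₀ + q₁ = 1
  · funext g k
    obtain ⟨rfl, rfl⟩ | ⟨rfl, rfl⟩ : (q₀ = 1 ∧ q₁ = 0) ∨ (q₀ = 0 ∧ q₁ = 1) := by omega
    · obtain ⟨x, rfl⟩ : ∃ x, g = ![x] := ⟨g 0, by ext i; fin_cases i; rfl⟩
      rw [Subsingleton.elim k ![], LieSuperalgebra.d_one_zero, h₀, ← hf0, hv]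
      exact (neg_eq_iff_eq_neg.2 (map_neg _ _))
    · obtain ⟨y, rfl⟩ : ∃ x, k = ![x] := ⟨k 0, by ext i; fin_cases i; rfl⟩
      rw [Subsingleton.elim g ![], LieSuperalgebra.d_zero_one, h₁, ← hf1, hv]
      exact (neg_eq_iff_eq_neg.2 (map_neg _ _))
  · rw [hc.2 q₀ q₁ h, LieSuperalgebra.d_apply_eq_zero _ ((SL K n m).cochainZero_mem _) h]

/-- The three components of a 2-cochain as restrictions of one bilinear map. -/
theorem exists_total (β₂₀ : (SL K n m).part 0 →ₗ[K] (SL K n m).part 0 →ₗ[K] SLIndex n m → K)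
    (β₁₁ : (SL K n m).part 0 →ₗ[K] (SL K n m).part 1 →ₗ[K] SLIndex n m → K)
    (β₀₂ : (SL K n m).part 1 →ₗ[K] (SL K n m).part 1 →ₗ[K] SLIndex n m → K) :
    ∃ B : (SLIndex n m → K) →ₗ[K] (SLIndex n m → K) →ₗ[K] SLIndex n m → K,
      (∀ x y : (SL K n m).part 0, B x y = β₂₀ x y) ∧
      (∀ (x : (SL K n m).part 0) (y : (SL K n m).part 1), B x y = β₁₁ x y) ∧
      (∀ (x : (SL K n m).part 0) (y : (SL K n m).part 1), B y x = -β₁₁ x y) ∧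
      ∀ x y : (SL K n m).part 1, B x y = β₀₂ x y := by
  -- The flipped term is subtracted because exchanging an even and an odd argument changes the sign.
  refine ⟨β₂₀.compl₁₂ (toPart 0) (toPart 0) + β₁₁.compl₁₂ (toPart 0) (toPart 1)
      - (β₁₁.compl₁₂ (toPart 0) (toPart 1)).flip + β₀₂.compl₁₂ (toPart 1) (toPart 1),
    fun x y => ?_, fun x y => ?_, fun x y => ?_, fun x y => ?_⟩ <;>
    simp [toPart_coe, toPart_coe_ne]

theorem cohomology_two [CharZero K] (hn : 2 ≤ n) (hm : 1 ≤ m) :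
    (SL K n m).cocycles 2 ≤ (SL K n m).coboundaries 2 := by
  rintro c ⟨hc, hd : (SL K n m).d c = 0⟩
  replace hc : c ∈ (SL K n m).cochains 2 := hc
  obtain ⟨β₂₀, h₂₀, hs₂₀⟩ := (hc.1 2 0 rfl).exists_two_zero
  obtain ⟨β₁₁, h₁₁⟩ := (hc.1 1 1 rfl).exists_one_one
  obtain ⟨β₀₂, h₀₂, hs₀₂⟩ := (hc.1 0 2 rfl).exists_zero_two
  obtain ⟨B, hB00, hB01, hB10, hB11⟩ := exists_total β₂₀ β₁₁ β₀₂
  have hEE : ∀ x y : (SL K n m).part 0,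
      (((SL K n m).brEE x y : (SL K n m).part 0) : SLIndex n m → K) = br K n m x y :=
    fun _ _ => rfl
  have hEO : ∀ (x : (SL K n m).part 0) (y : (SL K n m).part 1),
      (((SL K n m).brEO x y : (SL K n m).part 1) : SLIndex n m → K) = br K n m x y :=
    fun _ _ => rfl
  have hOO : ∀ x y : (SL K n m).part 1,
      (((SL K n m).brOO x y : (SL K n m).part 0) : SLIndex n m → K) = br K n m x y :=
    fun _ _ => rfl
  have hbr : ∀ x y, (SL K n m).bracket x y = br K n m x y := fun _ _ => rfl
  have hs00 : ∀ x y : (SL K n m).part 0, B x y = -B y x := fun x y => by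
    rw [hB00, hB00, hs₂₀]
  have hcoe : ∀ (p : ZMod 2) (a : SLIndex n m) (ha : parity a = p),
      (basisPart K a ha : SLIndex n m → K) = Pi.single a 1 := fun _ _ _ => rfl
  obtain ⟨e, he⟩ := exists_cob hn hm B
    (fun a b ha => by
      rcases exists_parity b with hb | hb
      · exact hs00 (basisPart K a ha) (basisPart K b hb)
      · rw [← hcoe _ a ha, ← hcoe _ b hb, hB01, hB10, neg_neg])
    (fun a b c' ha hb => by
      simp only [← br_single]
      rcases exists_parity c' with hc' | hc'
      · have := (SL K n m).d_three_zero c (basisPart K a ha) (basisPart K b hb) (basisPart K c' hc')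
        rw [hd] at this
        -- The differential puts the bracket in the first slot, while `exists_cob` expects [a, c']
        -- and [b, c'] in the second.
        have s1 := hs00 (basisPart K b hb) ((SL K n m).brEE (basisPart K a ha) (basisPart K c' hc'))
        have s2 := hs00 (basisPart K a ha) ((SL K n m).brEE (basisPart K b hb) (basisPart K c' hc'))
        simp only [h₂₀, Matrix.cons_val_zero, Matrix.cons_val_one, ← hB00, hEE, hbr, hcoe,
          Pi.zero_apply] at this s1 s2
        linear_combination (norm := module) -this + s1 - s2
      · have := (SL K n m).d_two_one c (basisPart K a ha) (basisPart K b hb) (basisPart K c' hc')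
        rw [hd] at this
        simp only [h₂₀, h₁₁, Matrix.cons_val_zero, Matrix.cons_val_one, ← hB00, ← hB01, hEE, hEO,
          hbr, hcoe, Pi.zero_apply] at this
        exact this.symm)
    (fun a b c' ha hb hc' => by
      simp only [← br_single]
      have := (SL K n m).d_one_two c (basisPart K a ha) (basisPart K b hb) (basisPart K c' hc')
      rw [hd] at this
      have s1 : B (basisPart K b hb) ((SL K n m).brEO (basisPart K a ha) (basisPart K c' hc')) =
          B ((SL K n m).brEO (basisPart K a ha) (basisPart K c' hc')) (basisPart K b hb) := by
        rw [hB11, hB11, hs₀₂]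
      -- Odd elements bracket to zero, which removes the term of the differential with [h_s, h_t].
      have s2 : br K n m (Pi.single b 1) (Pi.single c' 1) = 0 := by
        rw [br_single, table_odd K b c' hb hc']
      simp only [h₂₀, h₁₁, h₀₂, Matrix.cons_val_zero, Matrix.cons_val_one, ← hB00, ← hB01, ← hB11,
        hEO, hOO, hbr, hcoe, s2, map_zero, LinearMap.zero_apply, Pi.zero_apply] at this s1 ⊢
      linear_combination (norm := module) -this + s1)
  refine ⟨_, (SL K n m).cochainOne_mem e, ?_⟩
  have he' : ∀ a b : SLIndex n m, parity a = 0 → B (Pi.single a 1) (Pi.single b 1) =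
      cob 1 e (Pi.single a 1) (Pi.single b 1) := fun a b ha => by rw [he, sgn_of_even_left ha]
  funext q₀ q₁
  by_cases h : q₀ + q₁ = 2
  · funext g k
    obtain ⟨rfl, rfl⟩ | ⟨rfl, rfl⟩ | ⟨rfl, rfl⟩ :
      (q₀ = 2 ∧ q₁ = 0) ∨ (q₀ = 1 ∧ q₁ = 1) ∨ (q₀ = 0 ∧ q₁ = 2) := by omega
    · obtain ⟨x, y, rfl⟩ : ∃ x y, g = ![x, y] := ⟨g 0, g 1, by ext i; fin_cases i <;> rfl⟩
      rw [Subsingleton.elim k ![], LieSuperalgebra.d_two_zero, h₂₀, ← hB00,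
        eq_cob_on_parts fun a b ha _ => he' a b ha, cob, one_smul]
      rfl
    · obtain ⟨x, rfl⟩ : ∃ x, g = ![x] := ⟨g 0, by ext i; fin_cases i; rfl⟩
      obtain ⟨y, rfl⟩ : ∃ x, k = ![x] := ⟨k 0, by ext i; fin_cases i; rfl⟩
      rw [LieSuperalgebra.d_one_one, h₁₁, ← hB01,
        eq_cob_on_parts fun a b ha _ => he' a b ha, cob, one_smul]
      rfl
    · obtain ⟨x, y, rfl⟩ : ∃ x y, k = ![x, y] := ⟨k 0, k 1, by ext i; fin_cases i <;> rfl⟩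
      rw [Subsingleton.elim g ![], LieSuperalgebra.d_zero_two, h₀₂, ← hB11,
        -- Cochains are symmetric in odd arguments, so the last term of the coboundary changes sign.
        eq_cob_on_parts (ε := -1) fun a b ha hb => by rw [he, sgn, if_pos ⟨ha, hb⟩],
        cob, neg_smul, one_smul, ← sub_eq_add_neg]
      rfl
  · rw [hc.2 q₀ q₁ h, LieSuperalgebra.d_apply_eq_zero _ ((SL K n m).cochainOne_mem _) h]

end SLIndex

theorem corollary4p1 (K : Type*) [Field K] [CharZero K] (n m : ℕ) (hn : 2 ≤ n) (hm : 1 ≤ m) :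
    (SL K n m).IsComplete := by
  intro i hi
  refine LieSuperalgebra.subsingleton_cohomology _ ?_
  interval_cases i
  · exact SLIndex.cohomology_zero hn hm
  · exact SLIndex.cohomology_one hn hm
  · exact SLIndex.cohomology_two hn hm
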